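/- Consider a discrete-time load balancing system with one dispatcher and $N\ge 2$ servers, each with an infinite queue. In time-slot $t$ a number $A_\Sigma(t)\in\{0,1,2,\dots\}$ of tasks arrives, all of which are routed at once to a single server, and server $n$ offers service $S_n(t)\in\{0,1,2,\dots\}$; if $A_n(t)$ tasks are routed to server $n$, its queue length evolves as $$Q_n(t+1)=\max\{Q_n(t)+A_n(t)-S_n(t),0\}.$$ The arrivals $A_\Sigma(t)$ are i.i.d. over time, the service vectors $(S_n(t))_n$ are i.i.d. over time, the services are independent across servers and of the arrivals. The services are bounded, $S_n(t)$ has mean $\mu_n$ and variance $\nu_n^2$, and the servers are homogeneous: all $\mu_n$ are equal. Put $\mu_\Sigma=\sum_n\mu_n>0$ and $\nu_\Sigma^2=\sum_n\nu_n^2$. The service law is fixed, and the arrival law is indexed by $\epsilon\in(0,\mu_\Sigma)$: $A_\Sigma^{(\epsilon)}(t)$ has mean $\mu_\Sigma-\epsilon$, is bounded by a constant $A_{\max}$ that does not depend on $\epsilon$, satisfies $\mathbb P(A_\Sigma^{(\epsilon)}(t)=0)>0$, and its variance converges to a constant $\sigma_\Sigma^2$ as $\epsilon\downarrow 0$. Let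 $\zeta=\sigma_\Sigma^2+\nu_\Sigma^2$. Under Join-Below-Threshold (JBT) with threshold $r$, the dispatcher keeps a set $m(t)$ of server IDs. If there are arrivals and $m(t)\neq\emptyset$, they are sent to a server drawn uniformly from $m(t)$, whose ID is removed; if $m(t)=\emptyset$, they are sent to a server drawn uniformly from all servers. At the end of the slot every server whose ID is not in the memory and whose queue length is $<r$ puts its ID into the memory. (JIQ is the case $r=1$.) Under random routing, arrivals are always sent to a server drawn uniformly from all servers. For every $\epsilon\in(0,\mu_\Sigma)$ the Markov chain $\mathbf Q(t)$ under random routing, and the Markov chain $(\mathbf Q(t),m(t))$ under JBT with any threshold $r>0$, have a unique stationary distribution; let $\overline{\mathbf Q}_{\mathrm{Rand}}^{(\epsilon)}$ and $\overline{\mathbf Q}^{(\epsilon)}$ denote the corresponding steady-state queue length vectors. Then the limit $$L=\lim_{\epsilon\downarrow0}\epsilon\,\mathbb E\Big[\sum_n\overline Q_{n,\mathrm{Rand}}^{(\epsilon)}\Big]$$ exists and is finite, and the following hold. (1) Suppose moreover that $\mathbb P(A_\Sigma^{(\epsilon)}(t)=0)$ is bounded below by a positive constant for all small $\epsilon$.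 If the threshold is any constant $r\in[1,\infty)$, then $$\frac{\zeta}{2}<\liminf_{\epsilon\downarrow0}\epsilon\,\mathbb E\Big[\sum_n\overline Q_n^{(\epsilon)}\Big]\quad\text{and}\quad\limsup_{\epsilon\downarrow0}\epsilon\,\mathbb E\Big[\sum_n\overline Q_n^{(\epsilon)}\Big]<L.$$ In particular JBT with a constant threshold is not heavy-traffic delay optimal, i.e. $\limsup_{\epsilon\downarrow0}\epsilon\,\mathbb E[\sum_n\overline Q_n^{(\epsilon)}]\le\zeta/2$ fails. (2) If the threshold is $r^{(\epsilon)}=(1/\epsilon)^{1+\alpha}$ with a constant $\alpha>0$, then $$\lim_{\epsilon\downarrow0}\epsilon\,\mathbb E\Big[\sum_n\overline Q_n^{(\epsilon)}\Big]=L.$$ -/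

import Mathlib

open Filter Topology MeasureTheory ProbabilityTheory
open scoped ENNReal NNReal

namespace LoadBalancing

/-- Mean of a law on `ℕ`. -/
noncomputable def mean (p : PMF ℕ) : ℝ := ∫ k : ℕ, (k : ℝ) ∂p.toMeasure

/-- Variance of a law on `ℕ`. -/
noncomputable def var (p : PMF ℕ) : ℝ := variance (fun k : ℕ => (k : ℝ)) p.toMeasure

section Model

variable {ι : Type*}

/-- Law of the service offered by server `n` in one time-slot, where `S` is the joint law of the
services offered by all the servers in one time-slot. -/
noncomputable def serviceLaw (S : PMF (ι → ℕ)) (n : ι) : PMF ℕ := S.map (fun s => s n)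

/-- Queue lengths at the end of a time-slot that starts with queue lengths `Q`, when all `a`
new tasks are routed to server `n` and server `k` offers service `s k`. The subtraction is the
truncated one, so that an empty queue leaves service unused. -/
def nextQueue [DecidableEq ι] (Q : ι → ℕ) (a : ℕ) (s : ι → ℕ) (n : ι) : ι → ℕ :=
  fun k => Q k + (if k = n then a else 0) - s k

/-- The queue recursion `Q(t+1) = Q(t) + A(t) - S(t) + U(t)` with unused service
`U(t) = max (S(t) - Q(t) - A(t)) 0`. -/
theorem nextQueue_eq [DecidableEq ι] (Q : ι → ℕ) (a : ℕ) (s : ι → ℕ) (n k : ι) :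
    (nextQueue Q a s n k : ℤ) =
      Q k + (if k = n then (a : ℤ) else 0) - s k
        + max (s k - Q k - (if k = n then (a : ℤ) else 0)) 0 := by
  unfold nextQueue
  split_ifs <;> omega

variable [Fintype ι]

/-- Total service rate of the system. -/
noncomputable def totalServiceRate (S : PMF (ι → ℕ)) : ℝ := ∑ n, mean (serviceLaw S n)

/-- Sum of the variances of the services of the individual servers. -/
noncomputable def totalServiceVar (S : PMF (ι → ℕ)) : ℝ := ∑ n, var (serviceLaw S n)

variable [DecidableEq ι]

/-- A state `(Q, m)` of the system: the queue lengths, and the set of the server IDs that are in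
the memory of the dispatcher. -/
abbrev State (ι : Type*) := (ι → ℕ) × Finset ι

/-- Memory at the end of a time-slot. If there were new arrivals, the ID `n` of the chosen server
has been removed from the memory `m` (if it was there at all); then every server whose ID is not
in the memory and whose queue length is below `r` reports its ID. -/
noncomputable def nextMemory (r : ℝ) (m : Finset ι) (a : ℕ) (n : ι) (Q' : ι → ℕ) : Finset ι :=
  (if a = 0 then m else m.erase n) ∪ Finset.univ.filter (fun k => (Q' k : ℝ) < r)

variable [Nonempty ι]

/-- The dispatching decision with memory `m`: uniform on the servers in the memory if there are
any, otherwise uniform on all the servers. -/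
noncomputable def dispatch (m : Finset ι) : PMF ι :=
  if h : m.Nonempty then PMF.uniformOfFinset m h else PMF.uniformOfFintype ι

/-- One time-slot under Join-Below-Threshold with threshold `r`, arrival law `A` and joint service
law `S`: the arrivals, the services and the dispatching decision are drawn independently. -/
noncomputable def jbtStep (r : ℝ) (A : PMF ℕ) (S : PMF (ι → ℕ)) (z : State ι) : PMF (State ι) :=
  A.bind fun a => S.bind fun s => (dispatch z.2).map fun n =>
    (nextQueue z.1 a s n, nextMemory r z.2 a n (nextQueue z.1 a s n))

/-- One time-slot under random routing: all new tasks are sent to a uniformly chosen server. -/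
noncomputable def randStep (A : PMF ℕ) (S : PMF (ι → ℕ)) (Q : ι → ℕ) : PMF (ι → ℕ) :=
  A.bind fun a => S.bind fun s => (PMF.uniformOfFintype ι).map fun n => nextQueue Q a s n

end Model

/-- `π` is a stationary (steady-state) distribution of the Markov chain with transition law `K`. -/
def IsStationary {X : Type*} (K : X → PMF X) (π : PMF X) : Prop := π.bind K = π

/-- Expected sum of the queue lengths, when `π` is the law of the queue length vector. -/
noncomputable def meanTotalQueue {ι : Type*} [Fintype ι] (π : PMF (ι → ℕ)) : ℝ≥0∞ :=
  ∑' Q : ι → ℕ, π Q * ∑ n, (Q n : ℝ≥0∞)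

/-- `ε` times the expected sum of the queue lengths, for a family of laws of the queue length
vector. -/
noncomputable def scaledMean {ι : Type*} [Fintype ι] (q : ℝ → PMF (ι → ℕ)) (ε : ℝ) : ℝ≥0∞ :=
  ENNReal.ofReal ε * meanTotalQueue (q ε)

/-- Heavy-traffic delay optimality in steady state of a family of steady-state laws of the queue
length vector, where `ζ` is the limiting variance of arrivals plus total service. -/
def HeavyTrafficDelayOptimal {ι : Type*} [Fintype ι] (ζ : ℝ) (q : ℝ → PMF (ι → ℕ)) : Prop :=
  limsup (scaledMean q) (𝓝[>] 0) ≤ ENNReal.ofReal (ζ / 2)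

end LoadBalancing

open LoadBalancing

/-!
# Join-Below-Threshold in heavy traffic

The memory of the dispatcher is redundant. If it consists exactly of the servers whose queue is
below the threshold, it keeps doing so, because the only queue that can grow in a time-slot is one
whose ID is not, or no longer, in the memory. As the empty system is reachable from every state,
stationary distributions are unique, so the one of the full chain comes from a chain of queue
lengths alone, `thresholdStep`, of which random routing is the instance with threshold `0`. The
Foster–Lyapunov criterion (`exists_isStationary_of_drift`) with power sums of the queue lengths
provides stationary distributions together with the moment bounds `E[(∑ Q)^k] ≤ C_k / ε^k`, with
constants that do not depend on the threshold (`exists_moment_bound`).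

Let `N` be the number of servers, `μ` the total service rate, `U` the total unused service of a
time-slot, and `Q⁺` the queue lengths at its end. Let `D` be the mean difference between the
average queue length and the queue length at the chosen server (`imbalance`), and
`X = E[(∑ Q⁺) U]` (`meanCross`). With `L` the limit under random routing, the stationarity of
`∑ Q²` and of `(∑ Q)²` gives

* `ε E[∑ Q] = L - N μ D + o(1)` (`tendsto_add_imbalance`),
* `ε E[∑ Q] = ζ / 2 + X + o(1)` (`tendsto_sub_cross`).

Hence `X + N μ D` tends to `L - ζ / 2`, which is positive because there are at least two servers.

For a constant threshold, `X` and `D` control each other. Whenever service is lost some queue is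
empty, so that the others contribute to the imbalance (`integral_meanCross_le`); and an imbalance
needs a queue below the threshold, which a few slots without arrivals turn, with probability bounded
below, into lost service while the other queues have hardly changed (`integral_imbalance_le`). Since
their weighted sum has a positive limit, both stay bounded away from `0`, and both strict
inequalities follow (`exists_strict_bounds`).

For the threshold `(1 / ε) ^ (1 + α)`, an imbalance needs a queue of at least that length, and the
moment bound of an order `k + 1` with `k α > 1` shows that `D` tends to `0`
(`tendsto_imbalance_of_threshold`).
-/

set_option linter.unusedSectionVars false

namespace LoadBalancing

/-! ### Stationary distributions of Markov chains on a discrete space -/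

section Markov

variable {X : Type*} {K : X → PMF X}

/-- A weight `w` is invariant under the transition law `K`. -/
def InvariantWeight (K : X → PMF X) (w : X → ℝ≥0∞) : Prop :=
  ∀ y, ∑' x, w x * K x y = w y

theorem IsStationary.invariantWeight {π : PMF X} (h : IsStationary K π) :
    InvariantWeight K π := fun y => by
  rw [← PMF.bind_apply]; exact congrArg (fun p : PMF X => p y) h

theorem isStationary_of_invariantWeight {π : PMF X} (h : InvariantWeight K π) :
    IsStationary K π := PMF.ext fun y => by rw [PMF.bind_apply]; exact h y

/-- Fubini for one transition of a Markov chain. -/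
theorem tsum_weight_mul_step {Y : Type*} (K : X → PMF Y) (w : X → ℝ≥0∞) (f : Y → ℝ≥0∞) :
    ∑' x, w x * ∑' y, K x y * f y = ∑' y, (∑' x, w x * K x y) * f y := by
  simp_rw [← ENNReal.tsum_mul_left, ← ENNReal.tsum_mul_right, mul_assoc]
  exact ENNReal.tsum_comm

theorem tsum_step_mass (K : X → PMF X) (w : X → ℝ≥0∞) :
    ∑' y, ∑' x, w x * K x y = ∑' x, w x := by
  have h := tsum_weight_mul_step K w (fun _ => 1)
  simp only [mul_one, PMF.tsum_coe] at h
  exact h.symm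

theorem IsStationary.tsum_step {π : PMF X} (h : IsStationary K π) (f : X → ℝ≥0∞) :
    ∑' x, π x * ∑' y, K x y * f y = ∑' x, π x * f x := by
  rw [tsum_weight_mul_step]
  exact tsum_congr fun y => by rw [h.invariantWeight y]

theorem eq_of_le_of_tsum_eq {f g : X → ℝ≥0∞} (hle : ∀ x, f x ≤ g x)
    (hsum : ∑' x, f x = ∑' x, g x) (hfin : ∑' x, f x ≠ ∞) : f = g := by
  by_contra hne
  obtain ⟨x, hx⟩ := Function.ne_iff.1 hne
  exact (ENNReal.tsum_lt_tsum hfin hle (lt_of_le_of_ne (hle x) hx)).ne hsum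

/-- A subinvariant weight of finite mass is invariant, because a transition preserves mass. -/
theorem InvariantWeight.of_le {w : X → ℝ≥0∞} (hfin : ∑' x, w x ≠ ∞)
    (hle : ∀ y, ∑' x, w x * K x y ≤ w y) : InvariantWeight K w :=
  congrFun (eq_of_le_of_tsum_eq hle (tsum_step_mass K w) (by rwa [tsum_step_mass]))

/-- The state `y` can be reached from the state `x`. -/
def Reaches (K : X → PMF X) : X → X → Prop := Relation.ReflTransGen fun x y => K x y ≠ 0

theorem InvariantWeight.ne_zero_of_reaches {w : X → ℝ≥0∞} (hw : InvariantWeight K w) {x y : X}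
    (hxy : Reaches K x y) (hx : w x ≠ 0) : w y ≠ 0 := by
  induction hxy with
  | refl => exact hx
  | tail _ hbc ih =>
    rw [← hw]
    exact ne_of_gt (lt_of_lt_of_le (pos_iff_ne_zero.2 (mul_ne_zero ih hbc)) (ENNReal.le_tsum _))

/-- Two stationary distributions agree as soon as some state can be reached from every state: what
remains of the two after the removal of their common part is invariant, mutually singular, and
would charge that state. -/
theorem IsStationary.unique {z : X} (hz : ∀ x, Reaches K x z) {π ρ : PMF X}
    (hπ : IsStationary K π) (hρ : IsStationary K ρ) : π = ρ := by
  set m : X → ℝ≥0∞ := fun x => min (π x) (ρ x) with hm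
  have hmπ : ∀ x, m x ≤ π x := fun x => min_le_left _ _
  have hmρ : ∀ x, m x ≤ ρ x := fun x => min_le_right _ _
  have hmfin : ∑' x, m x ≠ ∞ :=
    ne_top_of_le_ne_top (by rw [PMF.tsum_coe]; exact ENNReal.one_ne_top) (ENNReal.tsum_le_tsum hmπ)
  have hminv : InvariantWeight K m := by
    refine InvariantWeight.of_le hmfin fun y => le_min ?_ ?_
    · rw [← hπ.invariantWeight y]
      exact ENNReal.tsum_le_tsum fun x => mul_le_mul_left (hmπ x) _
    · rw [← hρ.invariantWeight y]
      exact ENNReal.tsum_le_tsum fun x => mul_le_mul_left (hmρ x) _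
  have key : ∀ {p : PMF X}, IsStationary K p → (∀ x, m x ≤ p x) → p z - m z = 0 →
      ∑' x, m x = 1 := by
    intro p hp hmp hz0
    have hinv : InvariantWeight K fun x => p x - m x := by
      intro y
      have hle : ∀ x, m x * K x y ≤ p x * K x y := fun x => mul_le_mul_left (hmp x) _
      have hfin : ∑' x, m x * K x y ≠ ∞ := by
        rw [hminv y]; exact ne_top_of_le_ne_top (p.apply_ne_top y) (hmp y)
      calc ∑' x, (p x - m x) * K x y = ∑' x, (p x * K x y - m x * K x y) :=
            tsum_congr fun x => ENNReal.sub_mul fun _ _ => (K x).apply_ne_top y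
        _ = p y - m y := by
            rw [← hp.invariantWeight y, ← hminv y]
            refine ENNReal.eq_sub_of_add_eq hfin ?_
            rw [← ENNReal.tsum_add]
            exact tsum_congr fun x => tsub_add_cancel_of_le (hle x)
    have hall : ∀ x, p x - m x = 0 := fun x => by
      by_contra hx
      exact hinv.ne_zero_of_reaches (hz x) hx hz0
    rw [← p.tsum_coe]
    exact tsum_congr fun x => le_antisymm (hmp x) (tsub_eq_zero_iff_le.1 (hall x))
  have hone : ∑' x, m x = 1 := by
    rcases le_total (π z) (ρ z) with h | h
    · exact key hπ hmπ (by simp [hm, h])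
    · exact key hρ hmρ (by simp [hm, h])
  have h1 := eq_of_le_of_tsum_eq hmπ (by rw [hone, π.tsum_coe]) hmfin
  have h2 := eq_of_le_of_tsum_eq hmρ (by rw [hone, ρ.tsum_coe]) hmfin
  exact PMF.ext fun x => by rw [← h1, ← h2]

/-- The law of the chain with transition law `K` after `n` steps from `x`. -/
noncomputable def iterate (K : X → PMF X) (x : X) : ℕ → PMF X
  | 0 => PMF.pure x
  | n + 1 => (iterate K x n).bind K

theorem tsum_iterate_succ (K : X → PMF X) (x : X) (n : ℕ) (f : X → ℝ≥0∞) :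
    ∑' y, iterate K x (n + 1) y * f y = ∑' y, iterate K x n y * ∑' z, K y z * f z := by
  rw [tsum_weight_mul_step]
  exact tsum_congr fun y => by rw [iterate, PMF.bind_apply]

theorem tsum_iterate_add_sum_le {V f : X → ℝ≥0∞} {b : ℝ≥0∞}
    (hdrift : ∀ x, ∑' y, K x y * V y + f x ≤ V x + b) (x : X) (n : ℕ) :
    ∑' y, iterate K x n y * V y + ∑ k ∈ Finset.range n, ∑' y, iterate K x k y * f y
      ≤ V x + n * b := by
  induction n with
  | zero =>
    simp only [iterate, Finset.range_zero, Finset.sum_empty, Nat.cast_zero, zero_mul, add_zero]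
    rw [tsum_eq_single x (fun y hy => by simp [PMF.pure_apply, hy])]
    simp
  | succ n ih =>
    have h1 : ∑' y, iterate K x (n + 1) y * V y + ∑' y, iterate K x n y * f y
        ≤ ∑' y, iterate K x n y * V y + b := by
      rw [tsum_iterate_succ, ← ENNReal.tsum_add]
      calc _ ≤ ∑' y, (iterate K x n y * V y + iterate K x n y * b) :=
            ENNReal.tsum_le_tsum fun y => by
              rw [← mul_add, ← mul_add]; exact mul_le_mul_right (hdrift y) _
        _ = _ := by rw [ENNReal.tsum_add, ENNReal.tsum_mul_right, PMF.tsum_coe, one_mul]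
    rw [Finset.sum_range_succ]
    calc _ = (∑' y, iterate K x (n + 1) y * V y + ∑' y, iterate K x n y * f y)
            + ∑ k ∈ Finset.range n, ∑' y, iterate K x k y * f y := by ring
      _ ≤ (∑' y, iterate K x n y * V y + b)
            + ∑ k ∈ Finset.range n, ∑' y, iterate K x k y * f y := by gcongr
      _ = (∑' y, iterate K x n y * V y
            + ∑ k ∈ Finset.range n, ∑' y, iterate K x k y * f y) + b := by ring
      _ ≤ V x + n * b + b := by gcongr
      _ = _ := by push_cast; ring

/-- The average of the laws of the chain over its first `n + 1` steps. -/
noncomputable def cesaro (K : X → PMF X) (x : X) (n : ℕ) (y : X) : ℝ≥0∞ :=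
  (∑ k ∈ Finset.range (n + 1), iterate K x k y) * ((n : ℝ≥0∞) + 1)⁻¹

theorem tsum_cesaro_mul (K : X → PMF X) (x : X) (n : ℕ) (f : X → ℝ≥0∞) :
    ∑' y, cesaro K x n y * f y =
      (∑ k ∈ Finset.range (n + 1), ∑' y, iterate K x k y * f y) * ((n : ℝ≥0∞) + 1)⁻¹ := by
  rw [← Summable.tsum_finsetSum (fun _ _ => ENNReal.summable), ← ENNReal.tsum_mul_right]
  refine tsum_congr fun y => ?_
  rw [cesaro, ← Finset.sum_mul]; ring

theorem nat_add_one_mul_inv (n : ℕ) : ((n : ℝ≥0∞) + 1) * ((n : ℝ≥0∞) + 1)⁻¹ = 1 :=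
  ENNReal.mul_inv_cancel (by simp) (by simp)

theorem tsum_cesaro (K : X → PMF X) (x : X) (n : ℕ) : ∑' y, cesaro K x n y = 1 := by
  have h := tsum_cesaro_mul K x n (fun _ => 1)
  simp only [mul_one, PMF.tsum_coe, Finset.sum_const, Finset.card_range, nsmul_eq_mul] at h
  rw [h]; push_cast; exact nat_add_one_mul_inv n

theorem tsum_cesaro_mul_step_le (K : X → PMF X) (x : X) (n : ℕ) (y : X) :
    ∑' z, cesaro K x n z * K z y ≤ cesaro K x n y + ((n : ℝ≥0∞) + 1)⁻¹ := by
  rw [tsum_cesaro_mul, cesaro]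
  have h : ∀ k, ∑' z, iterate K x k z * K z y = iterate K x (k + 1) y := fun k => by
    rw [iterate, PMF.bind_apply]
  simp_rw [h]
  calc _ ≤ (∑ k ∈ Finset.range (n + 1 + 1), iterate K x k y) * ((n : ℝ≥0∞) + 1)⁻¹ := by
        rw [Finset.sum_range_succ' _ (n + 1)]; gcongr; exact le_self_add
    _ ≤ (∑ k ∈ Finset.range (n + 1), iterate K x k y + 1) * ((n : ℝ≥0∞) + 1)⁻¹ := by
        rw [Finset.sum_range_succ _ (n + 1)]; gcongr; exact PMF.coe_le_one _ _
    _ = _ := by rw [add_mul, one_mul]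

theorem tsum_cesaro_mul_le {V f : X → ℝ≥0∞} {b : ℝ≥0∞}
    (hdrift : ∀ x, ∑' y, K x y * V y + f x ≤ V x + b) (x : X) (n : ℕ) :
    ∑' y, cesaro K x n y * f y ≤ V x * ((n : ℝ≥0∞) + 1)⁻¹ + b := by
  rw [tsum_cesaro_mul]
  calc _ ≤ (V x + (n + 1 : ℕ) * b) * ((n : ℝ≥0∞) + 1)⁻¹ := by
        gcongr; exact le_trans le_add_self (tsum_iterate_add_sum_le hdrift x (n + 1))
    _ = V x * ((n : ℝ≥0∞) + 1)⁻¹ + (((n : ℝ≥0∞) + 1) * ((n : ℝ≥0∞) + 1)⁻¹) * b := by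
        push_cast; ring
    _ = _ := by rw [nat_add_one_mul_inv, one_mul]

theorem tendsto_nat_add_one_inv : Tendsto (fun n : ℕ => ((n : ℝ≥0∞) + 1)⁻¹) atTop (𝓝 0) := by
  have := (tendsto_add_atTop_iff_nat 1).2 ENNReal.tendsto_inv_nat_nhds_zero
  simpa using this

/-- The Foster–Lyapunov criterion: a drift inequality whose cost function `f` has finite sublevel
sets gives a stationary distribution, under which the mean cost is at most `b`. It is a pointwise
limit, along an ultrafilter, of the averaged laws of the chain; the drift inequality keeps mass
from escaping to infinity. -/
theorem exists_isStationary_of_drift {V f : X → ℝ≥0∞} {b : ℝ≥0∞} (x₀ : X) (hV : V x₀ ≠ ∞)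
    (hb : b ≠ ∞) (hf : ∀ x, f x ≠ ∞) (hfin : ∀ M : ℕ, {x | f x ≤ M}.Finite)
    (hdrift : ∀ x, ∑' y, K x y * V y + f x ≤ V x + b) :
    ∃ π : PMF X, IsStationary K π ∧ ∑' x, π x * f x ≤ b := by
  classical
  set U : Ultrafilter ℕ := hyperfilter ℕ
  have hU : (U : Filter ℕ) ≤ atTop := by
    rw [← Nat.cofinite_eq_atTop]; exact hyperfilter_le_cofinite
  have hlim : ∀ x, ∃ l, Tendsto (fun n => cesaro K x₀ n x) U (𝓝 l) := fun x => by
    obtain ⟨l, -, hl⟩ := isCompact_univ.ultrafilter_le_nhds (U.map fun n => cesaro K x₀ n x)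
      (by simp)
    exact ⟨l, hl⟩
  choose w hw using hlim
  have hbound : Tendsto (fun n : ℕ => V x₀ * ((n : ℝ≥0∞) + 1)⁻¹ + b) U (𝓝 b) := by
    have := (ENNReal.Tendsto.const_mul tendsto_nat_add_one_inv (Or.inr hV)).add_const b
    simp only [mul_zero, zero_add] at this
    exact this.mono_left hU
  have hsum : ∀ (F : Finset X) (g : X → ℝ≥0∞), (∀ x, g x ≠ ∞) →
      Tendsto (fun n => ∑ x ∈ F, cesaro K x₀ n x * g x) U (𝓝 (∑ x ∈ F, w x * g x)) :=
    fun F g hg => tendsto_finsetSum _ fun x _ => ENNReal.Tendsto.mul_const (hw x) (Or.inr (hg x))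
  have hsumle : ∀ (g : X → ℝ≥0∞) (u : ℕ → ℝ≥0∞) (c : ℝ≥0∞), (∀ x, g x ≠ ∞) →
      (∀ n, ∑' x, cesaro K x₀ n x * g x ≤ u n) → Tendsto u U (𝓝 c) →
      ∑' x, w x * g x ≤ c := by
    intro g u c hg hu hc
    rw [ENNReal.tsum_eq_iSup_sum]
    exact iSup_le fun F => le_of_tendsto_of_tendsto' (hsum F g hg) hc
      fun n => (ENNReal.sum_le_tsum F).trans (hu n)
  have hcost : ∑' x, w x * f x ≤ b :=
    hsumle f _ b hf (fun n => tsum_cesaro_mul_le hdrift x₀ n) hbound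
  have hle_one : ∑' x, w x ≤ 1 := by
    simpa using hsumle (fun _ => 1) (fun _ => 1) 1 (by simp)
      (fun n => by simp [tsum_cesaro]) tendsto_const_nhds
  have hge_one : 1 ≤ ∑' x, w x := by
    have hM : ∀ M : ℕ, 1 ≤ ∑' x, w x + b * ((M : ℝ≥0∞) + 1)⁻¹ := by
      intro M
      set F := (hfin (M + 1)).toFinset with hF
      have hn : ∀ n, 1 ≤ ∑ x ∈ F, cesaro K x₀ n x * 1
          + (V x₀ * ((n : ℝ≥0∞) + 1)⁻¹ + b) * ((M : ℝ≥0∞) + 1)⁻¹ := by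
        intro n
        have h1 : ∑' x, cesaro K x₀ n x ≤
            ∑' x, ((if x ∈ F then cesaro K x₀ n x else 0)
              + cesaro K x₀ n x * f x * ((M : ℝ≥0∞) + 1)⁻¹) := by
          refine ENNReal.tsum_le_tsum fun x => ?_
          split_ifs with hx
          · exact le_self_add
          · have hx' : (M : ℝ≥0∞) + 1 ≤ f x := by
              simp only [hF, Set.Finite.mem_toFinset, Set.mem_ofPred_eq, not_le] at hx
              exact_mod_cast hx.le
            rw [zero_add, mul_assoc]
            calc cesaro K x₀ n x = cesaro K x₀ n x * (((M : ℝ≥0∞) + 1) * ((M : ℝ≥0∞) + 1)⁻¹) := by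
                  rw [nat_add_one_mul_inv, mul_one]
              _ ≤ _ := by gcongr
        rw [tsum_cesaro, ENNReal.tsum_add, ENNReal.tsum_mul_right] at h1
        refine h1.trans (add_le_add ?_ ?_)
        · rw [tsum_eq_sum (s := F) (fun x hx => by simp [hx])]
          exact Finset.sum_le_sum fun x hx => by simp [hx]
        · gcongr
          exact tsum_cesaro_mul_le hdrift x₀ n
      have hl := (hsum F (fun _ => 1) (by simp)).add
        (ENNReal.Tendsto.mul_const (b := ((M : ℝ≥0∞) + 1)⁻¹) hbound (Or.inr (by simp)))
      refine (ge_of_tendsto' hl hn).trans ?_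
      simp only [mul_one]
      gcongr
      exact ENNReal.sum_le_tsum F
    have hl := (ENNReal.Tendsto.const_mul tendsto_nat_add_one_inv (Or.inr hb)).const_add
      (∑' x, w x)
    simp only [mul_zero, add_zero] at hl
    exact ge_of_tendsto' hl hM
  have hone : ∑' x, w x = 1 := le_antisymm hle_one hge_one
  have hinv : InvariantWeight K w := by
    refine InvariantWeight.of_le (by simp [hone]) fun y => ?_
    refine hsumle (fun x => K x y) _ _ (fun x => (K x).apply_ne_top y)
      (fun n => tsum_cesaro_mul_step_le K x₀ n y) ?_
    simpa using (hw y).add (tendsto_nat_add_one_inv.mono_left hU)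
  exact ⟨⟨w, hone ▸ ENNReal.summable.hasSum⟩, isStationary_of_invariantWeight hinv, hcost⟩

end Markov

/-! ### Exact knowledge of the short queues -/

section Reduction

variable {ι : Type*}

theorem nextQueue_zero_le [DecidableEq ι] (Q : ι → ℕ) (s : ι → ℕ) (n k : ι) : nextQueue Q 0 s n k ≤ Q k := by
  simp [nextQueue]

theorem nextQueue_zero_eq [DecidableEq ι] (Q s : ι → ℕ) (n n' : ι) :
    nextQueue Q 0 s n = nextQueue Q 0 s n' := by
  funext k; simp [nextQueue]

variable [Fintype ι]

/-- The servers whose queue length is below `R`. -/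
def shortQueues (R : ℕ) (Q : ι → ℕ) : Finset ι := Finset.univ.filter fun k => Q k < R

theorem mem_shortQueues {R : ℕ} {Q : ι → ℕ} {k : ι} : k ∈ shortQueues R Q ↔ Q k < R := by
  simp [shortQueues]

/-- The state in which the memory consists exactly of the servers with queue length below `R`. -/
def consistentState (R : ℕ) (Q : ι → ℕ) : State ι := (Q, shortQueues R Q)

variable [DecidableEq ι]

theorem sum_nextQueue_zero_lt {Q s : ι → ℕ} {i : ι} (hQ : Q i ≠ 0) (hs : s i ≠ 0) (n : ι) :
    ∑ k, nextQueue Q 0 s n k < ∑ k, Q k :=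
  Finset.sum_lt_sum (fun k _ => nextQueue_zero_le Q s n k)
    ⟨i, Finset.mem_univ i, by simp only [nextQueue, ite_self]; omega⟩

/-- Exact knowledge of the short queues persists: the only queue that can grow during a time-slot
is the one whose ID has just been removed from the memory. -/
theorem nextMemory_shortQueues (r : ℝ) (Q : ι → ℕ) (a : ℕ) (s : ι → ℕ) (n : ι) :
    nextMemory r (shortQueues ⌈r⌉₊ Q) a n (nextQueue Q a s n)
      = shortQueues ⌈r⌉₊ (nextQueue Q a s n) := by
  ext k
  simp only [nextMemory, Finset.mem_union, Finset.mem_filter, Finset.mem_univ, true_and,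
    mem_shortQueues, Nat.lt_ceil]
  refine ⟨?_, Or.inr⟩
  rintro (h | h)
  · refine lt_of_le_of_lt (Nat.cast_le.2 ?_) (?_ : (Q k : ℝ) < r)
    · split_ifs at h with ha
      · subst ha; exact nextQueue_zero_le Q s n k
      · simp [nextQueue, Finset.ne_of_mem_erase h]
    · split_ifs at h
      · exact Nat.lt_ceil.1 (mem_shortQueues.1 h)
      · exact Nat.lt_ceil.1 (mem_shortQueues.1 (Finset.mem_of_mem_erase h))
  · exact h

variable [Nonempty ι]

/-- One time-slot of the queue lengths alone, when the tasks are sent to a uniformly chosen server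
with queue length below `R` if there is one, and to a uniformly chosen server otherwise. For
`R = 0` this is random routing. -/
noncomputable def thresholdStep (R : ℕ) (A : PMF ℕ) (S : PMF (ι → ℕ)) (Q : ι → ℕ) : PMF (ι → ℕ) :=
  A.bind fun a => S.bind fun s => (dispatch (shortQueues R Q)).map fun n => nextQueue Q a s n

theorem randStep_eq_thresholdStep (A : PMF ℕ) (S : PMF (ι → ℕ)) :
    randStep A S = thresholdStep 0 A S := by
  funext Q
  simp [randStep, thresholdStep, shortQueues, dispatch]

theorem jbtStep_consistentState (r : ℝ) (A : PMF ℕ) (S : PMF (ι → ℕ)) (Q : ι → ℕ) :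
    jbtStep r A S (consistentState ⌈r⌉₊ Q)
      = (thresholdStep ⌈r⌉₊ A S Q).map (consistentState ⌈r⌉₊) := by
  simp only [jbtStep, thresholdStep, PMF.map_bind, PMF.map_comp]
  simp only [consistentState, nextMemory_shortQueues]
  rfl

theorem isStationary_map_consistentState {r : ℝ} {A : PMF ℕ} {S : PMF (ι → ℕ)} {π : PMF (ι → ℕ)}
    (h : IsStationary (thresholdStep ⌈r⌉₊ A S) π) :
    IsStationary (jbtStep r A S) (π.map (consistentState ⌈r⌉₊)) := by
  unfold IsStationary at *
  rw [PMF.bind_map]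
  conv_rhs => rw [← h, PMF.map_bind]
  exact congrArg _ (funext fun Q => jbtStep_consistentState r A S Q)

theorem thresholdStep_ne_zero {R : ℕ} {A : PMF ℕ} {S : PMF (ι → ℕ)} (hA : A 0 ≠ 0) {s : ι → ℕ}
    (hs : S s ≠ 0) (Q : ι → ℕ) (n : ι) :
    thresholdStep R A S Q (nextQueue Q 0 s n) ≠ 0 := by
  obtain ⟨n', hn'⟩ := (dispatch (shortQueues R Q)).support_nonempty
  rw [← PMF.mem_support_iff]
  simp only [thresholdStep, PMF.mem_support_bind_iff, PMF.mem_support_map_iff]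
  refine ⟨0, hA, s, hs, n', hn', ?_⟩
  exact nextQueue_zero_eq Q s n' n

theorem jbtStep_ne_zero {r : ℝ} {A : PMF ℕ} {S : PMF (ι → ℕ)} (hA : A 0 ≠ 0) {s : ι → ℕ}
    (hs : S s ≠ 0) (Q : ι → ℕ) (m : Finset ι) (n : ι) :
    jbtStep r A S (Q, m) (nextQueue Q 0 s n, nextMemory r m 0 n (nextQueue Q 0 s n)) ≠ 0 := by
  obtain ⟨n', hn'⟩ := (dispatch m).support_nonempty
  rw [← PMF.mem_support_iff]
  simp only [jbtStep, PMF.mem_support_bind_iff, PMF.mem_support_map_iff]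
  refine ⟨0, hA, s, hs, n', hn', ?_⟩
  simp [nextQueue_zero_eq Q s n' n, nextMemory]

/-- From every state the system can empty, in a stretch of time-slots without arrivals. -/
theorem thresholdStep_reaches_zero {R : ℕ} {A : PMF ℕ} {S : PMF (ι → ℕ)} (hA : A 0 ≠ 0)
    (hS : ∀ i, ∃ s, S s ≠ 0 ∧ s i ≠ 0) (Q : ι → ℕ) : Reaches (thresholdStep R A S) Q 0 := by
  induction hq : ∑ k, Q k using Nat.strong_induction_on generalizing Q with
  | _ q ih =>
    by_cases h0 : Q = 0
    · rw [h0]; exact Relation.ReflTransGen.refl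
    · obtain ⟨i, hi⟩ := Function.ne_iff.1 h0
      obtain ⟨s, hs, hsi⟩ := hS i
      exact Relation.ReflTransGen.head (thresholdStep_ne_zero hA hs Q i)
        (ih _ (hq ▸ sum_nextQueue_zero_lt hi hsi i) _ rfl)

theorem jbtStep_reaches_zero {r : ℝ} (hr : 0 < r) {A : PMF ℕ} {S : PMF (ι → ℕ)} (hA : A 0 ≠ 0)
    (hS : ∀ i, ∃ s, S s ≠ 0 ∧ s i ≠ 0) (z : State ι) :
    Reaches (jbtStep r A S) z (0, Finset.univ) := by
  obtain ⟨Q, m⟩ := z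
  induction hq : ∑ k, Q k using Nat.strong_induction_on generalizing Q m with
  | _ q ih =>
    by_cases h0 : Q = 0
    · obtain ⟨s, hs⟩ := S.support_nonempty
      refine Relation.ReflTransGen.single ?_
      have h := jbtStep_ne_zero (r := r) hA hs Q m (Classical.arbitrary ι)
      subst h0
      convert h using 2
      have h1 : nextQueue (0 : ι → ℕ) 0 s (Classical.arbitrary ι) = 0 := by
        ext; simp [nextQueue]
      rw [h1]
      refine Prod.ext rfl ?_
      simp [nextMemory, hr]
    · obtain ⟨i, hi⟩ := Function.ne_iff.1 h0
      obtain ⟨s, hs, hsi⟩ := hS i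
      exact Relation.ReflTransGen.head (jbtStep_ne_zero hA hs Q m i)
        (ih _ (hq ▸ sum_nextQueue_zero_lt hi hsi i) _ _ rfl)

end Reduction

/-! ### Averages over arrivals, services and routing -/

section FiniteMean

variable {α : Type*}

/-- The mean of `f` under a law whose support is contained in the finite set `T`. -/
noncomputable def finMean (p : PMF α) (T : Finset α) (f : α → ℝ) : ℝ := ∑ x ∈ T, (p x).toReal * f x

variable (p : PMF α) {T : Finset α}

theorem finMean_add (f g : α → ℝ) :
    finMean p T (fun x => f x + g x) = finMean p T f + finMean p T g := by
  simp [finMean, mul_add, Finset.sum_add_distrib]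

theorem finMean_sub (f g : α → ℝ) :
    finMean p T (fun x => f x - g x) = finMean p T f - finMean p T g := by
  simp [finMean, mul_sub, Finset.sum_sub_distrib]

theorem finMean_const_mul (c : ℝ) (f : α → ℝ) :
    finMean p T (fun x => c * f x) = c * finMean p T f := by
  simp only [finMean, Finset.mul_sum]
  exact Finset.sum_congr rfl fun _ _ => by ring

theorem finMean_mul_const (c : ℝ) (f : α → ℝ) :
    finMean p T (fun x => f x * c) = finMean p T f * c := by
  simp only [finMean, Finset.sum_mul, mul_assoc]

theorem finMean_sum {κ : Type*} (s : Finset κ) (f : κ → α → ℝ) :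
    finMean p T (fun x => ∑ i ∈ s, f i x) = ∑ i ∈ s, finMean p T (f i) := by
  simp only [finMean, Finset.mul_sum]
  exact Finset.sum_comm

theorem finMean_comm {β : Type*} (q : PMF β) {U : Finset β} (f : α → β → ℝ) :
    finMean p T (fun x => finMean q U (f x)) = finMean q U fun y => finMean p T fun x => f x y := by
  simp only [finMean, Finset.mul_sum]
  rw [Finset.sum_comm]
  exact Finset.sum_congr rfl fun _ _ => Finset.sum_congr rfl fun _ _ => by ring

variable {p}

theorem finMean_mono {f g : α → ℝ} (h : ∀ x ∈ T, p x ≠ 0 → f x ≤ g x) :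
    finMean p T f ≤ finMean p T g :=
  Finset.sum_le_sum fun x hx => by
    by_cases h0 : p x = 0
    · simp [h0]
    · exact mul_le_mul_of_nonneg_left (h x hx h0) ENNReal.toReal_nonneg

theorem finMean_nonneg {f : α → ℝ} (h : ∀ x ∈ T, 0 ≤ f x) : 0 ≤ finMean p T f :=
  Finset.sum_nonneg fun x hx => mul_nonneg ENNReal.toReal_nonneg (h x hx)

theorem single_le_finMean {f : α → ℝ} (h : ∀ x ∈ T, 0 ≤ f x) {x : α} (hx : x ∈ T) :
    (p x).toReal * f x ≤ finMean p T f :=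
  Finset.single_le_sum (f := fun x => (p x).toReal * f x)
    (fun x hx => mul_nonneg ENNReal.toReal_nonneg (h x hx)) hx

theorem ofReal_finMean (hT : p.support ⊆ T) {f : α → ℝ} (h : ∀ x, 0 ≤ f x) :
    ∑' x, p x * ENNReal.ofReal (f x) = ENNReal.ofReal (finMean p T f) := by
  rw [finMean, ENNReal.ofReal_sum_of_nonneg
    fun x _ => mul_nonneg ENNReal.toReal_nonneg (h x), tsum_eq_sum (s := T)]
  · refine Finset.sum_congr rfl fun x _ => ?_
    rw [ENNReal.ofReal_mul ENNReal.toReal_nonneg, ENNReal.ofReal_toReal (p.apply_ne_top x)]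
  · intro x hx
    rw [(p.apply_eq_zero_iff x).2 fun h => hx (hT h), zero_mul]

theorem finMean_const (hT : p.support ⊆ T) (c : ℝ) : finMean p T (fun _ => c) = c := by
  have h1 : finMean p T (fun _ => 1) = 1 := by
    have h := ofReal_finMean hT (f := fun _ => 1) fun _ => zero_le_one
    simp only [ENNReal.ofReal_one, mul_one, PMF.tsum_coe] at h
    exact (ENNReal.ofReal_eq_one.1 h.symm)
  have := finMean_const_mul p (T := T) c fun _ => 1
  rwa [h1, mul_one] at this

theorem ae_mem_of_support_subset [MeasurableSpace α] [MeasurableSingletonClass α]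
    (hT : p.support ⊆ T) : ∀ᵐ x ∂p.toMeasure, x ∈ T := by
  rw [ae_iff]
  have : {x | ¬ x ∈ T} = (T : Set α)ᶜ := rfl
  rw [this, PMF.toMeasure_apply_eq_zero_iff _ T.measurableSet.compl]
  exact Set.disjoint_left.2 fun x hx hx' => hx' (hT hx)

theorem memLp_of_support_subset [MeasurableSpace α] [MeasurableSingletonClass α] [Countable α]
    (hT : p.support ⊆ T) (f : α → ℝ) (e : ℝ≥0∞) : MemLp f e p.toMeasure := by
  refine MemLp.of_bound (measurable_of_countable f).aestronglyMeasurable (∑ x ∈ T, |f x|) ?_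
  filter_upwards [ae_mem_of_support_subset hT] with x hx
  exact Finset.single_le_sum (f := fun x => |f x|) (fun x _ => abs_nonneg _) hx

theorem integral_eq_finMean [MeasurableSpace α] [MeasurableSingletonClass α] [Countable α]
    (hT : p.support ⊆ T) (f : α → ℝ) : ∫ x, f x ∂p.toMeasure = finMean p T f := by
  rw [PMF.integral_eq_tsum _ _ (memLp_one_iff_integrable.1 (memLp_of_support_subset hT f 1)),
    tsum_eq_sum (s := T), finMean]
  · rfl
  · intro x hx
    rw [(p.apply_eq_zero_iff x).2 fun h => hx (hT h)]; simp

end FiniteMean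

theorem tsum_bind_mul {α β : Type*} (p : PMF α) (K : α → PMF β) (f : β → ℝ≥0∞) :
    ∑' y, p.bind K y * f y = ∑' x, p x * ∑' y, K x y * f y := by
  simp_rw [PMF.bind_apply]; exact (tsum_weight_mul_step K p f).symm

theorem tsum_map_mul {α β : Type*} (p : PMF α) (g : α → β) (f : β → ℝ≥0∞) :
    ∑' y, p.map g y * f y = ∑' x, p x * f (g x) := by
  rw [PMF.map, tsum_bind_mul]
  refine tsum_congr fun x => ?_
  rw [tsum_eq_single (g x) (fun y hy => by simp [PMF.pure_apply, hy])]
  simp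

section Load

variable {ι : Type*} [Fintype ι] [DecidableEq ι] [Nonempty ι]

/-- The service vectors with entries at most `M`. -/
def serviceBox (ι : Type*) [Fintype ι] [DecidableEq ι] (M : ℕ) : Finset (ι → ℕ) :=
  Fintype.piFinset fun _ => Finset.range (M + 1)

theorem mem_serviceBox {M : ℕ} {s : ι → ℕ} : s ∈ serviceBox ι M ↔ ∀ i, s i ≤ M := by
  simp [serviceBox]

/-- The arrival law `A` and the service law `S` satisfy the standing assumptions: arrivals and
services are at most `M`, the servers are independent with equal rates, the arrival rate is `ε`
below the total service rate, and a time-slot can be without arrivals. -/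
structure IsLoad (M : ℕ) (ε : ℝ) (A : PMF ℕ) (S : PMF (ι → ℕ)) : Prop where
  arrival_support : A.support ⊆ Finset.range (M + 1)
  service_support : S.support ⊆ serviceBox ι M
  indep : iIndepFun (fun (n : ι) (s : ι → ℕ) => s n) S.toMeasure
  rate_eq : ∀ i, mean (serviceLaw S i) = totalServiceRate S / Fintype.card ι
  eps_pos : 0 < ε
  eps_lt : ε < totalServiceRate S
  arrival_mean : mean A = totalServiceRate S - ε
  arrival_zero : A 0 ≠ 0

/-- The mean of `g`, a function of the number of arrivals, the services and the chosen server, in a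
time-slot that starts with queue lengths `Q`. -/
noncomputable def noiseMean (M R : ℕ) (A : PMF ℕ) (S : PMF (ι → ℕ)) (Q : ι → ℕ)
    (g : ℕ → (ι → ℕ) → ι → ℝ) : ℝ :=
  finMean A (Finset.range (M + 1)) fun a => finMean S (serviceBox ι M) fun s =>
    finMean (dispatch (shortQueues R Q)) Finset.univ fun n => g a s n

namespace IsLoad

variable {M R : ℕ} {ε : ℝ} {A : PMF ℕ} {S : PMF (ι → ℕ)}

theorem finMean_arrival (h : IsLoad M ε A S) :
    finMean A (Finset.range (M + 1)) (fun a => (a : ℝ)) = totalServiceRate S - ε := by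
  rw [← h.arrival_mean, mean, integral_eq_finMean h.arrival_support]

theorem finMean_arrival_sq (h : IsLoad M ε A S) :
    finMean A (Finset.range (M + 1)) (fun a => (a : ℝ) ^ 2)
      = var A + (totalServiceRate S - ε) ^ 2 := by
  rw [var, variance_eq_sub (memLp_of_support_subset h.arrival_support _ _), ← h.arrival_mean, mean,
    ← integral_eq_finMean h.arrival_support]
  simp [Pi.pow_apply]

theorem mean_serviceLaw (hS : S.support ⊆ serviceBox ι M) (i : ι) :
    mean (serviceLaw S i) = finMean S (serviceBox ι M) fun s => (s i : ℝ) := by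
  rw [mean, serviceLaw, ← PMF.toMeasure_map (hf := measurable_of_countable _),
    integral_map (measurable_of_countable _).aemeasurable
      (measurable_of_countable _).aestronglyMeasurable, integral_eq_finMean hS]

theorem var_serviceLaw (S : PMF (ι → ℕ)) (i : ι) :
    var (serviceLaw S i) = variance (fun s : ι → ℕ => (s i : ℝ)) S.toMeasure := by
  rw [var, serviceLaw, ← PMF.toMeasure_map (hf := measurable_of_countable _),
    variance_map (measurable_of_countable _).aemeasurable (measurable_of_countable _).aemeasurable]
  rfl

theorem finMean_service (h : IsLoad M ε A S) (i : ι) :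
    finMean S (serviceBox ι M) (fun s => (s i : ℝ)) = totalServiceRate S / Fintype.card ι := by
  rw [← mean_serviceLaw h.service_support, h.rate_eq]

theorem finMean_service_sum (h : IsLoad M ε A S) :
    finMean S (serviceBox ι M) (fun s => ∑ i, (s i : ℝ)) = totalServiceRate S := by
  rw [finMean_sum, totalServiceRate]
  exact Finset.sum_congr rfl fun i _ => (mean_serviceLaw h.service_support i).symm

theorem finMean_service_sq (h : IsLoad M ε A S) :
    finMean S (serviceBox ι M) (fun s => ∑ i, (s i : ℝ) ^ 2)
      = totalServiceVar S + totalServiceRate S ^ 2 / Fintype.card ι := by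
  have h1 : ∀ i, finMean S (serviceBox ι M) (fun s => (s i : ℝ) ^ 2)
      = var (serviceLaw S i) + (totalServiceRate S / Fintype.card ι) ^ 2 := fun i => by
    rw [var_serviceLaw S,
      variance_eq_sub (memLp_of_support_subset h.service_support _ _), ← h.finMean_service i,
      ← integral_eq_finMean h.service_support, ← integral_eq_finMean h.service_support]
    simp [Pi.pow_apply]
  have hN : (Fintype.card ι : ℝ) ≠ 0 := by simp
  rw [finMean_sum, Finset.sum_congr rfl fun i _ => h1 i, Finset.sum_add_distrib, totalServiceVar]
  simp only [Finset.sum_const, Finset.card_univ, nsmul_eq_mul]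
  field_simp

theorem finMean_service_sum_sq (h : IsLoad M ε A S) :
    finMean S (serviceBox ι M) (fun s => (∑ i, (s i : ℝ)) ^ 2)
      = totalServiceVar S + totalServiceRate S ^ 2 := by
  have h0 : (∑ i, fun s : ι → ℕ => (s i : ℝ)) = fun s => ∑ i, (s i : ℝ) := by
    ext; simp
  have h1 : variance (∑ i, fun s : ι → ℕ => (s i : ℝ)) S.toMeasure = totalServiceVar S := by
    rw [IndepFun.variance_sum (fun i _ => memLp_of_support_subset h.service_support _ _)]
    · exact Finset.sum_congr rfl fun i _ => (var_serviceLaw S i).symm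
    · intro i _ j _ hij
      exact (h.indep.indepFun hij).comp (φ := fun k : ℕ => (k : ℝ)) (ψ := fun k : ℕ => (k : ℝ))
        (measurable_of_countable _) (measurable_of_countable _)
  rw [h0, variance_eq_sub (memLp_of_support_subset h.service_support _ _),
    integral_eq_finMean h.service_support, integral_eq_finMean h.service_support,
    h.finMean_service_sum] at h1
  exact eq_add_of_sub_eq h1

end IsLoad

section NoiseMean

variable {M R : ℕ} {ε : ℝ} {A : PMF ℕ} {S : PMF (ι → ℕ)} {Q : ι → ℕ}

theorem noiseMean_add (f g : ℕ → (ι → ℕ) → ι → ℝ) :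
    noiseMean M R A S Q (fun a s n => f a s n + g a s n)
      = noiseMean M R A S Q f + noiseMean M R A S Q g := by
  simp only [noiseMean, finMean_add]

theorem noiseMean_sub (f g : ℕ → (ι → ℕ) → ι → ℝ) :
    noiseMean M R A S Q (fun a s n => f a s n - g a s n)
      = noiseMean M R A S Q f - noiseMean M R A S Q g := by
  simp only [noiseMean, finMean_sub]

theorem noiseMean_const_mul (c : ℝ) (f : ℕ → (ι → ℕ) → ι → ℝ) :
    noiseMean M R A S Q (fun a s n => c * f a s n) = c * noiseMean M R A S Q f := by
  simp only [noiseMean, finMean_const_mul]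

theorem noiseMean_sum {κ : Type*} (t : Finset κ) (f : κ → ℕ → (ι → ℕ) → ι → ℝ) :
    noiseMean M R A S Q (fun a s n => ∑ i ∈ t, f i a s n) = ∑ i ∈ t, noiseMean M R A S Q (f i) := by
  simp only [noiseMean, finMean_sum]

theorem noiseMean_nonneg {f : ℕ → (ι → ℕ) → ι → ℝ} (h : ∀ a s n, 0 ≤ f a s n) :
    0 ≤ noiseMean M R A S Q f :=
  finMean_nonneg fun a _ => finMean_nonneg fun s _ => finMean_nonneg fun n _ => h a s n

theorem noiseMean_mono {f g : ℕ → (ι → ℕ) → ι → ℝ}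
    (h : ∀ a s n, a ≤ M → (∀ i, s i ≤ M) → f a s n ≤ g a s n) :
    noiseMean M R A S Q f ≤ noiseMean M R A S Q g :=
  finMean_mono fun a ha _ => finMean_mono fun s hs _ => finMean_mono fun n _ _ =>
    h a s n (Nat.lt_succ_iff.1 (Finset.mem_range.1 ha)) (mem_serviceBox.1 hs)

theorem noiseMean_congr {f g : ℕ → (ι → ℕ) → ι → ℝ} (h : ∀ a s n, f a s n = g a s n) :
    noiseMean M R A S Q f = noiseMean M R A S Q g := by
  have : f = g := funext fun a => funext fun s => funext fun n => h a s n
  rw [this]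

theorem dispatch_support_subset (m : Finset ι) :
    (dispatch m).support ⊆ ((Finset.univ : Finset ι) : Set ι) := by simp

theorem IsLoad.noiseMean_const (h : IsLoad M ε A S) (c : ℝ) :
    noiseMean M R A S Q (fun _ _ _ => c) = c := by
  simp only [noiseMean, finMean_const (dispatch_support_subset _),
    finMean_const h.service_support, finMean_const h.arrival_support]

theorem IsLoad.noiseMean_arrival (h : IsLoad M ε A S) (f : ℕ → ℝ) :
    noiseMean M R A S Q (fun a _ _ => f a) = finMean A (Finset.range (M + 1)) f := by
  simp only [noiseMean, finMean_const (dispatch_support_subset _),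
    finMean_const h.service_support]

theorem IsLoad.noiseMean_service (h : IsLoad M ε A S) (f : (ι → ℕ) → ℝ) :
    noiseMean M R A S Q (fun _ s _ => f s) = finMean S (serviceBox ι M) f := by
  simp only [noiseMean, finMean_const (dispatch_support_subset _),
    finMean_const h.arrival_support]

/-- The mean of `f` at the server chosen by the dispatcher. -/
noncomputable def routedMean (R : ℕ) (Q : ι → ℕ) (f : ι → ℝ) : ℝ :=
  finMean (dispatch (shortQueues R Q)) Finset.univ f

theorem IsLoad.noiseMean_arrival_mul_routed (h : IsLoad M ε A S) (f : ι → ℝ) :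
    noiseMean M R A S Q (fun a _ n => (a : ℝ) * f n)
      = (totalServiceRate S - ε) * routedMean R Q f := by
  simp only [noiseMean, finMean_const_mul, finMean_const h.service_support, finMean_mul_const,
    h.finMean_arrival, routedMean]

theorem IsLoad.noiseMean_arrival_mul_service (h : IsLoad M ε A S) :
    noiseMean M R A S Q (fun a s _ => (a : ℝ) * ∑ i, (s i : ℝ))
      = (totalServiceRate S - ε) * totalServiceRate S := by
  simp only [noiseMean, finMean_const (dispatch_support_subset _), finMean_const_mul,
    finMean_mul_const, h.finMean_arrival, h.finMean_service_sum]

theorem IsLoad.noiseMean_arrival_mul_routed_service (h : IsLoad M ε A S) :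
    noiseMean M R A S Q (fun a s n => (a : ℝ) * (s n : ℝ))
      = (totalServiceRate S - ε) * (totalServiceRate S / Fintype.card ι) := by
  simp only [noiseMean, finMean_const_mul]
  simp only [finMean_comm S, h.finMean_service, finMean_const (dispatch_support_subset _),
    finMean_mul_const, h.finMean_arrival]

/-- A time-slot of the chain, averaged over arrivals, services and dispatching decision. -/
theorem IsLoad.tsum_thresholdStep (h : IsLoad M ε A S) {f : (ι → ℕ) → ℝ} (hf : ∀ Q, 0 ≤ f Q) :
    ∑' Q', thresholdStep R A S Q Q' * ENNReal.ofReal (f Q')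
      = ENNReal.ofReal (noiseMean M R A S Q fun a s n => f (nextQueue Q a s n)) := by
  simp only [thresholdStep, tsum_bind_mul, tsum_map_mul]
  simp_rw [ofReal_finMean (dispatch_support_subset (shortQueues R Q)) (fun n => hf _)]
  simp_rw [ofReal_finMean h.service_support
    (fun s => finMean_nonneg (p := dispatch (shortQueues R Q)) (T := Finset.univ)
      fun n _ => hf (nextQueue Q _ s n))]
  rw [ofReal_finMean h.arrival_support
    (fun a => finMean_nonneg fun s _ => finMean_nonneg fun n _ => hf _)]
  rfl

end NoiseMean

end Load

/-! ### Drift of power sums and uniform moment bounds -/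

section Routing

variable {ι : Type*} [Fintype ι] [DecidableEq ι] [Nonempty ι] {R : ℕ} {Q : ι → ℕ}

theorem routedMean_of_nonempty (hm : (shortQueues R Q).Nonempty) (f : ι → ℝ) :
    routedMean R Q f = (∑ n ∈ shortQueues R Q, f n) / (shortQueues R Q).card := by
  rw [routedMean, dispatch, dif_pos hm, finMean, Finset.sum_div,
    ← Finset.sum_subset (Finset.subset_univ (shortQueues R Q))]
  · refine Finset.sum_congr rfl fun n hn => ?_
    rw [PMF.uniformOfFinset_apply_of_mem hm hn, ENNReal.toReal_inv, ENNReal.toReal_natCast]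
    ring
  · intro n _ hn
    rw [PMF.uniformOfFinset_apply_of_notMem hm hn]; simp

theorem routedMean_of_empty (hm : shortQueues R Q = ∅) (f : ι → ℝ) :
    routedMean R Q f = (∑ n, f n) / Fintype.card ι := by
  rw [routedMean, dispatch, dif_neg (by simp [hm]), finMean, Finset.sum_div]
  refine Finset.sum_congr rfl fun n _ => ?_
  rw [PMF.uniformOfFintype_apply, ENNReal.toReal_inv, ENNReal.toReal_natCast]
  ring

/-- The dispatcher favours short queues: the chosen server has on average at most the average of an
increasing function of the queue length. -/
theorem card_mul_routedMean_le {g : ℕ → ℝ} (hg : Monotone g) :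
    (Fintype.card ι : ℝ) * routedMean R Q (fun n => g (Q n)) ≤ ∑ n, g (Q n) := by
  have hN : (0 : ℝ) < Fintype.card ι := by exact_mod_cast Fintype.card_pos
  rcases (shortQueues R Q).eq_empty_or_nonempty with hm | hm
  · rw [routedMean_of_empty hm]
    exact le_of_eq (by field_simp)
  · have hk : (0 : ℝ) < (shortQueues R Q).card := by exact_mod_cast hm.card_pos
    have h1 : ∑ n ∈ shortQueues R Q, g (Q n) ≤ (shortQueues R Q).card * g R := by
      rw [← nsmul_eq_mul]
      exact Finset.sum_le_card_nsmul _ _ _ fun n hn => hg (mem_shortQueues.1 hn).le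
    have h2 : ((shortQueues R Q)ᶜ.card : ℝ) * g R ≤ ∑ n ∈ (shortQueues R Q)ᶜ, g (Q n) := by
      rw [← nsmul_eq_mul]
      refine Finset.card_nsmul_le_sum _ _ _ fun n hn => hg ?_
      rw [Finset.mem_compl, mem_shortQueues] at hn
      omega
    have h3 : ((shortQueues R Q)ᶜ.card : ℝ) = Fintype.card ι - (shortQueues R Q).card := by
      rw [Finset.card_compl, Nat.cast_sub (Finset.card_le_univ _)]
    have h4 : (0 : ℝ) ≤ (shortQueues R Q)ᶜ.card := Nat.cast_nonneg _
    rw [routedMean_of_nonempty hm, ← Finset.sum_add_sum_compl (shortQueues R Q)]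
    rw [mul_div_assoc', div_le_iff₀ hk]
    have h5 := mul_le_mul_of_nonneg_left h1 h4
    have h6 := mul_le_mul_of_nonneg_left h2 hk.le
    rw [h3] at h5 h6
    nlinarith

end Routing

section PowerDrift

/-- Second-order Taylor bound for powers of a queue length. -/
theorem exists_max_pow_le (M : ℝ) (hM : 0 ≤ M) (j : ℕ) :
    ∃ C : ℝ, 0 ≤ C ∧ ∀ x d : ℝ, 0 ≤ x → |d| ≤ M →
      max (x + d) 0 ^ (j + 2) ≤ x ^ (j + 2) + (j + 2) * x ^ (j + 1) * d + C * (1 + x) ^ j := by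
  induction j with
  | zero =>
    refine ⟨M ^ 2, sq_nonneg M, fun x d _ hd => ?_⟩
    have h1 : max (x + d) 0 ^ 2 ≤ (x + d) ^ 2 := by
      rcases le_total (x + d) 0 with h | h
      · rw [max_eq_right h]; nlinarith
      · rw [max_eq_left h]
    have h2 : d ^ 2 ≤ M ^ 2 := sq_le_sq' (by linarith [abs_le.1 hd]) (abs_le.1 hd).2
    simp only [zero_add, pow_one, pow_zero, Nat.cast_zero]
    nlinarith
  | succ j ih =>
    obtain ⟨C, hC, hj⟩ := ih
    refine ⟨(j + 3) * M ^ 2 + C * (1 + M), by positivity, fun x d hx hd => ?_⟩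
    have hd' := abs_le.1 hd
    have hd2 : d ^ 2 ≤ M ^ 2 := sq_le_sq' hd'.1 hd'.2
    have hxp : x ^ (j + 1) ≤ (1 + x) ^ (j + 1) := pow_le_pow_left₀ hx (by linarith) _
    have hxp0 : 0 ≤ x ^ (j + 1) := pow_nonneg hx _
    have hp0 : 0 ≤ (1 + x) ^ j := by positivity
    push_cast
    rcases le_total (x + d) 0 with h | h
    · rw [max_eq_right h, zero_pow (by omega)]
      have hxd : x * -d ≤ M ^ 2 := by nlinarith
      have e : (j + 1 + 2) * x ^ (j + 1 + 1) * d = -((j + 3) * (x ^ (j + 1) * (x * -d))) := by ring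
      rw [e]
      have h1 : x ^ (j + 1) * (x * -d) ≤ (1 + x) ^ (j + 1) * M ^ 2 :=
        mul_le_mul hxp hxd (mul_nonneg hx (by linarith)) (by positivity)
      have h2 : 0 ≤ C * (1 + M) * (1 + x) ^ (j + 1) := by positivity
      have h3 : 0 ≤ x ^ (j + 1 + 2) := by positivity
      have h4 := mul_le_mul_of_nonneg_left h1 (by positivity : (0 : ℝ) ≤ j + 3)
      nlinarith
    · rw [max_eq_left h]
      have h0 := hj x d hx hd
      rw [max_eq_left h] at h0
      have h1 := mul_le_mul_of_nonneg_left h0 h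
      have h2 : (x + d) * (1 + x) ^ j ≤ (1 + M) * (1 + x) ^ (j + 1) := by
        rw [pow_succ, mul_comm ((1 + x) ^ j), ← mul_assoc]
        exact mul_le_mul_of_nonneg_right (by nlinarith) hp0
      have h3 : x ^ (j + 1) * d ^ 2 ≤ (1 + x) ^ (j + 1) * M ^ 2 :=
        mul_le_mul hxp hd2 (sq_nonneg d) (by positivity)
      have h4 := mul_le_mul_of_nonneg_left h2 hC
      have h5 := mul_le_mul_of_nonneg_left h3 (by positivity : (0 : ℝ) ≤ j + 2)
      have h6 : 0 ≤ (1 + x) ^ (j + 1) * M ^ 2 := by positivity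
      calc (x + d) ^ (j + 1 + 2) = (x + d) * (x + d) ^ (j + 2) := by ring
        _ ≤ _ := h1
        _ = x ^ (j + 1 + 2) + (j + 1 + 2) * x ^ (j + 1 + 1) * d
            + (j + 2) * (x ^ (j + 1) * d ^ 2) + C * ((x + d) * (1 + x) ^ j) := by ring
        _ ≤ _ := by nlinarith

/-- A lower-order term is absorbed by a negative drift of order `ε`, at the price of a constant of
the order that the heavy-traffic scaling of the queue lengths by `ε` predicts. -/
theorem exists_lower_order_le (C N G : ℝ) (hC : 0 ≤ C) (hN : 0 < N) (hG : 0 < G) (j : ℕ) :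
    ∃ B : ℝ, 0 ≤ B ∧ ∀ ε x : ℝ, 0 < ε → ε ≤ G → 0 ≤ x →
      C * (1 + x) ^ j ≤ ε / N * x ^ (j + 1) + B / ε ^ j := by
  set T := C * 2 ^ j * N + G with hT
  have hT0 : 0 < T := by positivity
  refine ⟨C * (2 * T) ^ j, by positivity, fun ε x hε hεG hx => ?_⟩
  have h1 : 1 ≤ T / ε := by
    rw [le_div_iff₀ hε]
    have : 0 ≤ C * 2 ^ j * N := by positivity
    linarith
  rcases le_total (T / ε) x with h | h
  · have h2 : (1 + x) ^ j ≤ (2 * x) ^ j := pow_le_pow_left₀ (by linarith) (by linarith) _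
    have h3 : C * 2 ^ j ≤ ε / N * x := by
      rw [div_mul_eq_mul_div, le_div_iff₀ hN]
      rw [div_le_iff₀ hε] at h
      linarith
    have h4 := mul_le_mul_of_nonneg_left h2 hC
    have h5 := mul_le_mul_of_nonneg_right h3 (pow_nonneg hx j)
    have h6 : 0 ≤ C * (2 * T) ^ j / ε ^ j := by positivity
    rw [mul_pow] at h4
    rw [pow_succ]
    nlinarith
  · have h2 : (1 + x) ^ j ≤ (2 * (T / ε)) ^ j := pow_le_pow_left₀ (by linarith) (by linarith) _
    have h3 : C * (2 * T) ^ j / ε ^ j = C * (2 * (T / ε)) ^ j := by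
      rw [← mul_div_assoc, div_pow]; ring
    rw [h3]
    have h4 := mul_le_mul_of_nonneg_left h2 hC
    have h5 : 0 ≤ ε / N * x ^ (j + 1) := by positivity
    linarith

end PowerDrift

section Moments

variable {ι : Type*} [Fintype ι] [DecidableEq ι] [Nonempty ι]

theorem cast_nextQueue (Q : ι → ℕ) (a : ℕ) (s : ι → ℕ) (n k : ι) :
    (nextQueue Q a s n k : ℝ)
      = max ((Q k : ℝ) + ((if k = n then (a : ℝ) else 0) - s k)) 0 := by
  unfold nextQueue
  split_ifs
  · rcases le_total (s k) (Q k + a) with h | h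
    · have h' : (s k : ℝ) ≤ Q k + a := by exact_mod_cast h
      rw [Nat.cast_sub h, max_eq_left (by linarith)]; push_cast; ring
    · have h' : (Q k : ℝ) + a ≤ s k := by exact_mod_cast h
      rw [Nat.sub_eq_zero_of_le h, max_eq_right (by linarith), Nat.cast_zero]
  · rcases le_total (s k) (Q k + 0) with h | h
    · have h' : (s k : ℝ) ≤ Q k := by exact_mod_cast h
      rw [Nat.cast_sub h, max_eq_left (by linarith)]; push_cast; ring
    · have h' : (Q k : ℝ) ≤ s k := by exact_mod_cast h
      rw [Nat.sub_eq_zero_of_le h, max_eq_right (by linarith), Nat.cast_zero]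

variable {M R : ℕ} {ε : ℝ} {A : PMF ℕ} {S : PMF (ι → ℕ)}

namespace IsLoad

theorem rate_pos (h : IsLoad M ε A S) : 0 < totalServiceRate S := h.eps_pos.trans h.eps_lt

theorem exists_service_ne_zero (h : IsLoad M ε A S) (i : ι) : ∃ s, S s ≠ 0 ∧ s i ≠ 0 := by
  by_contra! hc
  have h1 : finMean S (serviceBox ι M) (fun s => (s i : ℝ)) ≤ 0 := by
    refine (finMean_mono (g := fun _ => 0) fun s _ hs => ?_).trans (by simp [finMean])
    rw [hc s hs, Nat.cast_zero]
  rw [h.finMean_service] at h1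
  have h2 := h.rate_pos
  have hN : (0 : ℝ) < Fintype.card ι := by exact_mod_cast Fintype.card_pos
  exact absurd h1 (not_le.2 (by positivity))

theorem unique (h : IsLoad M ε A S) {π ρ : PMF (ι → ℕ)}
    (hπ : IsStationary (thresholdStep R A S) π) (hρ : IsStationary (thresholdStep R A S) ρ) :
    π = ρ :=
  IsStationary.unique (thresholdStep_reaches_zero h.arrival_zero h.exists_service_ne_zero) hπ hρ

theorem jbt_unique (h : IsLoad M ε A S) {r : ℝ} (hr : 0 < r) {π ρ : PMF (State ι)}
    (hπ : IsStationary (jbtStep r A S) π) (hρ : IsStationary (jbtStep r A S) ρ) : π = ρ :=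
  IsStationary.unique (jbtStep_reaches_zero hr h.arrival_zero h.exists_service_ne_zero) hπ hρ

/-- The drift of a power sum of the queue lengths is negative to leading order: compared with a
uniform choice of server, the dispatcher can only reduce it. -/
theorem noiseMean_sum_pow_le (h : IsLoad M ε A S) {j : ℕ} {C : ℝ}
    (hC : ∀ x d : ℝ, 0 ≤ x → |d| ≤ M →
      max (x + d) 0 ^ (j + 2) ≤ x ^ (j + 2) + (j + 2) * x ^ (j + 1) * d + C * (1 + x) ^ j)
    (Q : ι → ℕ) :
    noiseMean M R A S Q (fun a s n => ∑ i, (nextQueue Q a s n i : ℝ) ^ (j + 2))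
        + (j + 2) * (ε / Fintype.card ι) * ∑ i, (Q i : ℝ) ^ (j + 1)
      ≤ ∑ i, (Q i : ℝ) ^ (j + 2) + ∑ i, C * (1 + (Q i : ℝ)) ^ j := by
  have hN : (0 : ℝ) < Fintype.card ι := by exact_mod_cast Fintype.card_pos
  have h1 : noiseMean M R A S Q (fun a s n => ∑ i, (nextQueue Q a s n i : ℝ) ^ (j + 2))
      ≤ noiseMean M R A S Q (fun a s n =>
          (∑ i, (Q i : ℝ) ^ (j + 2) + ∑ i, C * (1 + (Q i : ℝ)) ^ j)
          + ((j + 2) * ((a : ℝ) * (Q n : ℝ) ^ (j + 1))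
            - (j + 2) * ∑ i, (Q i : ℝ) ^ (j + 1) * (s i : ℝ))) := by
    refine noiseMean_mono fun a s n ha hs => ?_
    have ha' : (a : ℝ) ≤ M := by exact_mod_cast ha
    have e : (a : ℝ) * (Q n : ℝ) ^ (j + 1)
        = ∑ i, (Q i : ℝ) ^ (j + 1) * (if i = n then (a : ℝ) else 0) := by
      simp [mul_comm]
    rw [e, ← mul_sub, ← Finset.sum_sub_distrib, Finset.mul_sum, ← Finset.sum_add_distrib,
      ← Finset.sum_add_distrib]
    refine Finset.sum_le_sum fun i _ => ?_
    have hs' : (s i : ℝ) ≤ M := by exact_mod_cast hs i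
    have h0 := hC (Q i) ((if i = n then (a : ℝ) else 0) - s i) (Nat.cast_nonneg _) (by
      have : (0 : ℝ) ≤ s i := Nat.cast_nonneg _
      have : (0 : ℝ) ≤ a := Nat.cast_nonneg _
      split_ifs <;> rw [abs_le] <;> constructor <;> linarith)
    rw [cast_nextQueue]
    refine h0.trans (le_of_eq (by ring))
  have h2 : noiseMean M R A S Q (fun a s n =>
          (∑ i, (Q i : ℝ) ^ (j + 2) + ∑ i, C * (1 + (Q i : ℝ)) ^ j)
          + ((j + 2) * ((a : ℝ) * (Q n : ℝ) ^ (j + 1))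
            - (j + 2) * ∑ i, (Q i : ℝ) ^ (j + 1) * (s i : ℝ)))
      = (∑ i, (Q i : ℝ) ^ (j + 2) + ∑ i, C * (1 + (Q i : ℝ)) ^ j)
        + ((j + 2) * ((totalServiceRate S - ε) * routedMean R Q fun n => (Q n : ℝ) ^ (j + 1))
            - (j + 2) * ∑ i, (Q i : ℝ) ^ (j + 1) * (totalServiceRate S / Fintype.card ι)) := by
    rw [noiseMean_add, h.noiseMean_const, noiseMean_sub, noiseMean_const_mul, noiseMean_const_mul,
      h.noiseMean_arrival_mul_routed fun n => (Q n : ℝ) ^ (j + 1), noiseMean_sum]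
    simp only [noiseMean_const_mul]
    congr 3
    refine Finset.sum_congr rfl fun i _ => ?_
    rw [h.noiseMean_service fun s => (s i : ℝ), h.finMean_service]
  have h3 := card_mul_routedMean_le (R := R) (Q := Q) (g := fun k => (k : ℝ) ^ (j + 1))
    fun a b hab => pow_le_pow_left₀ (Nat.cast_nonneg _) (Nat.cast_le.2 hab) _
  set X := ∑ i, (Q i : ℝ) ^ (j + 1) with hX
  have h4 : (totalServiceRate S - ε) * routedMean R Q (fun n => (Q n : ℝ) ^ (j + 1))
      ≤ (totalServiceRate S - ε) * (X / Fintype.card ι) := by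
    refine mul_le_mul_of_nonneg_left ?_ (by linarith [h.eps_lt])
    rw [le_div_iff₀ hN]; linarith
  have h5 : (totalServiceRate S - ε) * (X / Fintype.card ι)
      = X * (totalServiceRate S / Fintype.card ι) - ε / Fintype.card ι * X := by ring
  rw [← Finset.sum_mul, ← hX] at h2
  have h6 := mul_le_mul_of_nonneg_left (h4.trans h5.le) (by positivity : (0 : ℝ) ≤ (j : ℝ) + 2)
  rw [mul_sub] at h6
  linarith [h1.trans h2.le]

end IsLoad

theorem finite_setOf_sum_pow_le (j : ℕ) (c : ℝ) :
    {Q : ι → ℕ | ∑ i, (Q i : ℝ) ^ (j + 1) ≤ c}.Finite := by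
  refine (serviceBox ι ⌊c⌋₊).finite_toSet.subset fun Q hQ => ?_
  rw [Finset.mem_coe, mem_serviceBox]
  intro i
  refine Nat.le_floor (le_trans ?_ hQ)
  have h1 : (Q i : ℝ) ≤ (Q i : ℝ) ^ (j + 1) := by
    exact_mod_cast Nat.le_self_pow (Nat.succ_ne_zero j) (Q i)
  exact h1.trans (Finset.single_le_sum (f := fun i => (Q i : ℝ) ^ (j + 1))
    (fun i _ => by positivity) (Finset.mem_univ i))

/-- For every threshold a stationary distribution exists, and its moments have the order of
magnitude of the heavy-traffic scaling, uniformly in the threshold. -/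
theorem exists_isStationary_moment (S : PMF (ι → ℕ)) (M j : ℕ) :
    ∃ C : ℝ, 0 ≤ C ∧ ∀ (ε : ℝ) (A : PMF ℕ) (R : ℕ), IsLoad M ε A S →
      ∃ π, IsStationary (thresholdStep R A S) π ∧
        ∑' Q, π Q * ENNReal.ofReal (∑ i, (Q i : ℝ) ^ (j + 1)) ≤ ENNReal.ofReal (C / ε ^ (j + 1)) := by
  by_cases hG : 0 < totalServiceRate S
  swap
  · exact ⟨0, le_rfl, fun ε A R h => absurd h.rate_pos hG⟩
  have hN : (0 : ℝ) < Fintype.card ι := by exact_mod_cast Fintype.card_pos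
  obtain ⟨C, hC0, hC⟩ := exists_max_pow_le (M : ℝ) (Nat.cast_nonneg M) j
  obtain ⟨B, hB0, hB⟩ := exists_lower_order_le C (Fintype.card ι) _ hC0 hN hG j
  refine ⟨Fintype.card ι * (Fintype.card ι * B), by positivity, fun ε A R h => ?_⟩
  have hε := h.eps_pos
  have hc : 0 < ε / Fintype.card ι := by positivity
  have hf0 : ∀ Q : ι → ℕ, 0 ≤ ε / Fintype.card ι * ∑ i, (Q i : ℝ) ^ (j + 1) := fun Q => by
    positivity
  obtain ⟨π, hπ, hle⟩ := exists_isStationary_of_drift (K := thresholdStep R A S)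
    (V := fun Q => ENNReal.ofReal (∑ i, (Q i : ℝ) ^ (j + 2)))
    (f := fun Q => ENNReal.ofReal (ε / Fintype.card ι * ∑ i, (Q i : ℝ) ^ (j + 1)))
    (b := ENNReal.ofReal (Fintype.card ι * B / ε ^ j)) 0 ENNReal.ofReal_ne_top
    ENNReal.ofReal_ne_top (fun _ => ENNReal.ofReal_ne_top) (fun K => by
      refine (finite_setOf_sum_pow_le j (K / (ε / Fintype.card ι))).subset fun Q hQ => ?_
      have hQ' : ENNReal.ofReal (ε / Fintype.card ι * ∑ i, (Q i : ℝ) ^ (j + 1)) ≤ K := hQ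
      rw [← ENNReal.ofReal_natCast, ENNReal.ofReal_le_ofReal_iff (Nat.cast_nonneg _)] at hQ'
      have h0 : ∑ i, (Q i : ℝ) ^ (j + 1) ≤ K / (ε / Fintype.card ι) := by
        rw [le_div_iff₀ hc]; linarith
      exact h0) (fun Q => by
      rw [h.tsum_thresholdStep fun Q => by positivity, ← ENNReal.ofReal_add
        (noiseMean_nonneg fun a s n => by positivity) (hf0 Q),
        ← ENNReal.ofReal_add (by positivity) (by positivity)]
      refine ENNReal.ofReal_le_ofReal ?_
      have h1 := h.noiseMean_sum_pow_le (R := R) hC Q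
      have h2 : ∑ i, C * (1 + (Q i : ℝ)) ^ j
          ≤ ∑ i, (ε / Fintype.card ι * (Q i : ℝ) ^ (j + 1) + B / ε ^ j) :=
        Finset.sum_le_sum fun i _ => hB ε (Q i) hε h.eps_lt.le (Nat.cast_nonneg _)
      rw [Finset.sum_add_distrib, ← Finset.mul_sum Finset.univ (fun i => (Q i : ℝ) ^ (j + 1)),
        Finset.sum_const, Finset.card_univ, nsmul_eq_mul, mul_div_assoc'] at h2
      have h3 : 0 ≤ (j : ℝ) * (ε / Fintype.card ι * ∑ i, (Q i : ℝ) ^ (j + 1)) :=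
        mul_nonneg (Nat.cast_nonneg j) (hf0 Q)
      nlinarith)
  refine ⟨π, hπ, ?_⟩
  have h1 : ∀ Q : ι → ℕ, π Q * ENNReal.ofReal (∑ i, (Q i : ℝ) ^ (j + 1))
      = ENNReal.ofReal (Fintype.card ι / ε) *
        (π Q * ENNReal.ofReal (ε / Fintype.card ι * ∑ i, (Q i : ℝ) ^ (j + 1))) := by
    intro Q
    rw [mul_left_comm, ← ENNReal.ofReal_mul (by positivity), ← mul_assoc]
    congr 2
    field_simp
  simp_rw [h1]
  rw [ENNReal.tsum_mul_left]
  refine (mul_le_mul_right hle _).trans ?_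
  rw [← ENNReal.ofReal_mul (by positivity)]
  refine ENNReal.ofReal_le_ofReal (le_of_eq ?_)
  rw [pow_succ]; field_simp

end Moments

/-! ### The queue recursion and its second-order expansions -/

section Steady

variable {ι : Type*} [Fintype ι] [DecidableEq ι] [Nonempty ι]

theorem lintegral_toMeasure (π : PMF (ι → ℕ)) (f : (ι → ℕ) → ℝ≥0∞) :
    ∫⁻ Q, f Q ∂π.toMeasure = ∑' Q, π Q * f Q := by
  rw [lintegral_countable']
  exact tsum_congr fun Q => by
    rw [PMF.toMeasure_apply_singleton _ _ (measurableSet_singleton Q), mul_comm]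

theorem integrable_iff_of_nonneg {π : PMF (ι → ℕ)} {f : (ι → ℕ) → ℝ} (hf : ∀ Q, 0 ≤ f Q) :
    Integrable f π.toMeasure ↔ ∑' Q, π Q * ENNReal.ofReal (f Q) ≠ ∞ := by
  rw [← lintegral_toMeasure, ← lt_top_iff_ne_top,
    ← hasFiniteIntegral_iff_ofReal (Eventually.of_forall hf)]
  exact ⟨fun h => h.2, fun h => ⟨(measurable_of_countable f).aestronglyMeasurable, h⟩⟩

theorem integral_of_nonneg {π : PMF (ι → ℕ)} {f : (ι → ℕ) → ℝ} (hf : ∀ Q, 0 ≤ f Q) :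
    ∫ Q, f Q ∂π.toMeasure = (∑' Q, π Q * ENNReal.ofReal (f Q)).toReal := by
  rw [integral_eq_lintegral_of_nonneg_ae (Eventually.of_forall hf)
    (measurable_of_countable f).aestronglyMeasurable, lintegral_toMeasure]

theorem integrable_of_le {π : PMF (ι → ℕ)} {f g : (ι → ℕ) → ℝ} (hg : Integrable g π.toMeasure)
    (hf : ∀ Q, 0 ≤ f Q) (hfg : ∀ Q, f Q ≤ g Q) : Integrable f π.toMeasure :=
  hg.mono' (measurable_of_countable f).aestronglyMeasurable
    (Eventually.of_forall fun Q => by rw [Real.norm_of_nonneg (hf Q)]; exact hfg Q)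

variable {M R : ℕ} {ε : ℝ} {A : PMF ℕ} {S : PMF (ι → ℕ)} {π : PMF (ι → ℕ)}

/-- In steady state a function of the queue lengths has the same mean at the start and at the end
of a time-slot. -/
theorem IsLoad.integral_step (h : IsLoad M ε A S) (hπ : IsStationary (thresholdStep R A S) π)
    {f : (ι → ℕ) → ℝ} (hf : ∀ Q, 0 ≤ f Q) (hi : Integrable f π.toMeasure) :
    Integrable (fun Q => noiseMean M R A S Q fun a s n => f (nextQueue Q a s n)) π.toMeasure ∧
      ∫ Q, noiseMean M R A S Q (fun a s n => f (nextQueue Q a s n)) ∂π.toMeasure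
        = ∫ Q, f Q ∂π.toMeasure := by
  have h0 : ∀ Q, 0 ≤ noiseMean M R A S Q fun a s n => f (nextQueue Q a s n) := fun Q =>
    noiseMean_nonneg fun a s n => hf _
  have h1 : ∑' Q, π Q * ENNReal.ofReal (noiseMean M R A S Q fun a s n => f (nextQueue Q a s n))
      = ∑' Q, π Q * ENNReal.ofReal (f Q) := by
    rw [← hπ.tsum_step fun Q => ENNReal.ofReal (f Q)]
    exact tsum_congr fun Q => by rw [h.tsum_thresholdStep hf]
  rw [integrable_iff_of_nonneg h0, integral_of_nonneg h0, integral_of_nonneg hf, h1]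
  exact ⟨(integrable_iff_of_nonneg hf).1 hi, rfl⟩

/-- The sum of the queue lengths. -/
def totalQueue (Q : ι → ℕ) : ℝ := ∑ i, (Q i : ℝ)

/-- The service of server `i` that is left unused in a time-slot. -/
def unusedService (Q : ι → ℕ) (a : ℕ) (s : ι → ℕ) (n i : ι) : ℕ :=
  s i - (Q i + if i = n then a else 0)

/-- The total service that is left unused in a time-slot. -/
def totalUnused (Q : ι → ℕ) (a : ℕ) (s : ι → ℕ) (n : ι) : ℝ := ∑ i, (unusedService Q a s n i : ℝ)

/-- How far the mean queue length at the chosen server is below the average queue length. -/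
noncomputable def imbalance (R : ℕ) (Q : ι → ℕ) : ℝ :=
  totalQueue Q / Fintype.card ι - routedMean R Q fun n => (Q n : ℝ)

theorem totalQueue_nonneg (Q : ι → ℕ) : 0 ≤ totalQueue Q :=
  Finset.sum_nonneg fun _ _ => Nat.cast_nonneg _

theorem totalUnused_nonneg (Q : ι → ℕ) (a : ℕ) (s : ι → ℕ) (n : ι) : 0 ≤ totalUnused Q a s n :=
  Finset.sum_nonneg fun _ _ => Nat.cast_nonneg _

theorem imbalance_nonneg (R : ℕ) (Q : ι → ℕ) : 0 ≤ imbalance R Q := by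
  have hN : (0 : ℝ) < Fintype.card ι := by exact_mod_cast Fintype.card_pos
  have h := card_mul_routedMean_le (R := R) (Q := Q) (g := fun k => (k : ℝ)) Nat.mono_cast
  rw [imbalance, sub_nonneg, le_div_iff₀ hN, mul_comm]
  exact h

theorem imbalance_le_totalQueue (R : ℕ) (Q : ι → ℕ) : imbalance R Q ≤ totalQueue Q := by
  have hN : (1 : ℝ) ≤ Fintype.card ι := by exact_mod_cast Fintype.card_pos (α := ι)
  have h1 : 0 ≤ routedMean R Q fun n => (Q n : ℝ) := finMean_nonneg fun _ _ => Nat.cast_nonneg _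
  have h2 : totalQueue Q / Fintype.card ι ≤ totalQueue Q := div_le_self (totalQueue_nonneg Q) hN
  rw [imbalance]; linarith

theorem imbalance_eq_zero_of_empty {Q : ι → ℕ} (hm : shortQueues R Q = ∅) :
    imbalance R Q = 0 := by
  rw [imbalance, routedMean_of_empty hm, totalQueue, sub_self]

theorem imbalance_eq_zero_of_lt {Q : ι → ℕ} (hQ : ∀ i, Q i < R) : imbalance R Q = 0 := by
  have h1 : shortQueues R Q = Finset.univ := by
    ext i; simp [mem_shortQueues, hQ i]
  rw [imbalance, routedMean_of_nonempty (by rw [h1]; exact Finset.univ_nonempty), h1,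
    Finset.card_univ, totalQueue, sub_self]

theorem totalQueue_le_of_lt {Q : ι → ℕ} {i : ι} (hi : Q i < R) :
    totalQueue Q ≤ Fintype.card ι * (imbalance R Q + R) := by
  have hN : (0 : ℝ) < Fintype.card ι := by exact_mod_cast Fintype.card_pos
  have hm : (shortQueues R Q).Nonempty := ⟨i, mem_shortQueues.2 hi⟩
  have hk : (0 : ℝ) < (shortQueues R Q).card := by exact_mod_cast hm.card_pos
  have h1 : routedMean R Q (fun n => (Q n : ℝ)) ≤ R := by
    rw [routedMean_of_nonempty hm, div_le_iff₀ hk, mul_comm, ← nsmul_eq_mul]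
    exact Finset.sum_le_card_nsmul _ _ _ fun n hn =>
      Nat.cast_le.2 (mem_shortQueues.1 hn).le
  have h2 : totalQueue Q = Fintype.card ι * (totalQueue Q / Fintype.card ι) := by field_simp
  rw [h2]
  refine mul_le_mul_of_nonneg_left ?_ hN.le
  rw [imbalance]
  have h3 : totalQueue Q / Fintype.card ι
      = (Fintype.card ι * (totalQueue Q / Fintype.card ι)) / Fintype.card ι := by rw [← h2]
  linarith

theorem nextQueue_add_service (Q : ι → ℕ) (a : ℕ) (s : ι → ℕ) (n i : ι) :
    (nextQueue Q a s n i : ℝ) + s i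
      = Q i + (if i = n then (a : ℝ) else 0) + unusedService Q a s n i := by
  have h : nextQueue Q a s n i + s i = Q i + (if i = n then a else 0) + unusedService Q a s n i := by
    unfold nextQueue unusedService; omega
  have h' := congrArg (Nat.cast (R := ℝ)) h
  push_cast at h'
  exact h'

/-- Service is left unused only by a server whose queue is empty at the end of the time-slot. -/
theorem nextQueue_mul_unusedService (Q : ι → ℕ) (a : ℕ) (s : ι → ℕ) (n i : ι) :
    (nextQueue Q a s n i : ℝ) * unusedService Q a s n i = 0 := by
  have h : nextQueue Q a s n i = 0 ∨ unusedService Q a s n i = 0 := by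
    unfold nextQueue unusedService; omega
  rcases h with h | h <;> simp [h]

theorem unusedService_le (Q : ι → ℕ) (a : ℕ) (s : ι → ℕ) (n i : ι) :
    unusedService Q a s n i ≤ s i := Nat.sub_le _ _

theorem totalUnused_le {Q : ι → ℕ} {a : ℕ} {s : ι → ℕ} {n : ι} (hs : ∀ i, s i ≤ M) :
    totalUnused Q a s n ≤ Fintype.card ι * M := by
  rw [totalUnused, ← nsmul_eq_mul]
  exact Finset.sum_le_card_nsmul _ _ _ fun i _ =>
    Nat.cast_le.2 ((unusedService_le Q a s n i).trans (hs i))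

theorem totalQueue_nextQueue (Q : ι → ℕ) (a : ℕ) (s : ι → ℕ) (n : ι) :
    totalQueue (nextQueue Q a s n)
      = totalQueue Q + a - ∑ i, (s i : ℝ) + totalUnused Q a s n := by
  have h := Finset.sum_congr (s₁ := Finset.univ) rfl
    fun i _ => nextQueue_add_service Q a s n i
  simp only [Finset.sum_add_distrib, Finset.sum_ite_eq', Finset.mem_univ, if_true] at h
  rw [totalQueue, totalQueue, totalUnused]
  linarith

theorem sum_nextQueue_sq (Q : ι → ℕ) (a : ℕ) (s : ι → ℕ) (n : ι) :
    ∑ i, (nextQueue Q a s n i : ℝ) ^ 2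
      = ∑ i, (Q i : ℝ) ^ 2 + (2 * ((a : ℝ) * Q n) - 2 * ∑ i, (Q i : ℝ) * s i)
        + ((a : ℝ) ^ 2 - 2 * ((a : ℝ) * s n) + ∑ i, (s i : ℝ) ^ 2)
        - ∑ i, (unusedService Q a s n i : ℝ) ^ 2 := by
  have e1 : (a : ℝ) * Q n = ∑ i, (Q i : ℝ) * (if i = n then (a : ℝ) else 0) := by simp [mul_comm]
  have e2 : (a : ℝ) * s n = ∑ i, (s i : ℝ) * (if i = n then (a : ℝ) else 0) := by simp [mul_comm]
  have e3 : (a : ℝ) ^ 2 = ∑ i : ι, (if i = n then (a : ℝ) else 0) ^ 2 := by simp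
  rw [e1, e2, e3]
  simp only [Finset.mul_sum, ← Finset.sum_add_distrib, ← Finset.sum_sub_distrib]
  refine Finset.sum_congr rfl fun i _ => ?_
  have h1 := nextQueue_add_service Q a s n i
  have h2 := nextQueue_mul_unusedService Q a s n i
  have h3 : (nextQueue Q a s n i : ℝ)
      = Q i + (if i = n then (a : ℝ) else 0) - s i + unusedService Q a s n i := by linarith
  set x := (if i = n then (a : ℝ) else 0)
  have h4 : (nextQueue Q a s n i : ℝ) - unusedService Q a s n i = Q i + x - s i := by linarith
  have h5 : ((nextQueue Q a s n i : ℝ) - unusedService Q a s n i) ^ 2 = (Q i + x - s i) ^ 2 := by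
    rw [h4]
  nlinarith

/-- The mean unused service in a time-slot that starts with queue lengths `Q`. -/
noncomputable def meanUnused (M R : ℕ) (A : PMF ℕ) (S : PMF (ι → ℕ)) (Q : ι → ℕ) : ℝ :=
  noiseMean M R A S Q fun a s n => totalUnused Q a s n

/-- The mean product of the total queue length at the end of a time-slot and the unused service.
Since a server with unused service has an empty queue, this is the amount of work that waits at the
other servers while service is lost. -/
noncomputable def meanCross (M R : ℕ) (A : PMF ℕ) (S : PMF (ι → ℕ)) (Q : ι → ℕ) : ℝ :=
  noiseMean M R A S Q fun a s n => totalQueue (nextQueue Q a s n) * totalUnused Q a s n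

namespace IsLoad

theorem noiseMean_totalQueue (h : IsLoad M ε A S) (Q : ι → ℕ) :
    noiseMean M R A S Q (fun a s n => totalQueue (nextQueue Q a s n))
      = totalQueue Q - ε + meanUnused M R A S Q := by
  simp only [totalQueue_nextQueue, noiseMean_add, noiseMean_sub, h.noiseMean_const,
    h.noiseMean_arrival fun a => (a : ℝ), h.noiseMean_service fun s => ∑ i, (s i : ℝ),
    h.finMean_arrival, h.finMean_service_sum, meanUnused]
  ring

theorem noiseMean_sum_sq (h : IsLoad M ε A S) (Q : ι → ℕ) :
    noiseMean M R A S Q (fun a s n => ∑ i, (nextQueue Q a s n i : ℝ) ^ 2)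
      = ∑ i, (Q i : ℝ) ^ 2 - 2 * (ε / Fintype.card ι) * totalQueue Q
        - 2 * (totalServiceRate S - ε) * imbalance R Q
        + (var A + totalServiceVar S + totalServiceRate S ^ 2 * (1 - 1 / Fintype.card ι)
            + ε ^ 2 - 2 * ε * totalServiceRate S * (1 - 1 / Fintype.card ι))
        - noiseMean M R A S Q (fun a s n => ∑ i, (unusedService Q a s n i : ℝ) ^ 2) := by
  have h1 : ∀ i, noiseMean M R A S Q (fun _ s _ => (Q i : ℝ) * (s i : ℝ))
      = (Q i : ℝ) * (totalServiceRate S / Fintype.card ι) := fun i => by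
    rw [noiseMean_const_mul, h.noiseMean_service fun s => (s i : ℝ), h.finMean_service]
  simp only [sum_nextQueue_sq, noiseMean_add, noiseMean_sub, h.noiseMean_const,
    noiseMean_const_mul, h.noiseMean_arrival_mul_routed fun n => (Q n : ℝ),
    h.noiseMean_arrival_mul_routed_service, h.noiseMean_arrival fun a => (a : ℝ) ^ 2,
    h.noiseMean_service fun s => ∑ i, (s i : ℝ) ^ 2, h.finMean_arrival_sq, h.finMean_service_sq]
  rw [noiseMean_sum Finset.univ fun i _ s _ => (Q i : ℝ) * (s i : ℝ),
    Finset.sum_congr rfl fun i _ => h1 i, ← Finset.sum_mul, imbalance]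
  rw [totalQueue]
  ring

theorem noiseMean_totalQueue_sq (h : IsLoad M ε A S) (Q : ι → ℕ) :
    noiseMean M R A S Q (fun a s n => totalQueue (nextQueue Q a s n) ^ 2)
      = totalQueue Q ^ 2 - 2 * ε * totalQueue Q + (var A + totalServiceVar S + ε ^ 2)
        + 2 * meanCross M R A S Q - noiseMean M R A S Q (fun a s n => totalUnused Q a s n ^ 2) := by
  have e : ∀ a s n, totalQueue (nextQueue Q a s n) ^ 2
      = totalQueue Q ^ 2 + 2 * totalQueue Q * ((a : ℝ) - ∑ i, (s i : ℝ))
        + ((a : ℝ) ^ 2 - 2 * ((a : ℝ) * ∑ i, (s i : ℝ)) + (∑ i, (s i : ℝ)) ^ 2)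
        + 2 * (totalQueue (nextQueue Q a s n) * totalUnused Q a s n) - totalUnused Q a s n ^ 2 := by
    intro a s n
    rw [totalQueue_nextQueue]; ring
  rw [noiseMean_congr e]
  simp only [noiseMean_add, noiseMean_sub, h.noiseMean_const,
    noiseMean_const_mul, h.noiseMean_arrival_mul_service, h.noiseMean_arrival fun a => (a : ℝ) ^ 2,
    h.noiseMean_arrival fun a => (a : ℝ), h.noiseMean_service fun s => ∑ i, (s i : ℝ),
    h.noiseMean_service fun s => (∑ i, (s i : ℝ)) ^ 2, h.finMean_arrival_sq,
    h.finMean_service_sum_sq, h.finMean_arrival, h.finMean_service_sum, meanCross]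
  ring

end IsLoad

end Steady

/-! ### Balance equations in steady state -/

section Identities

variable {ι : Type*} [Fintype ι] [DecidableEq ι] [Nonempty ι]

/-- Moments of the total queue length in steady state, uniformly in the threshold. -/
theorem exists_moment_bound (S : PMF (ι → ℕ)) (M k : ℕ) :
    ∃ C : ℝ, 0 ≤ C ∧ ∀ (ε : ℝ) (A : PMF ℕ) (R : ℕ) (π : PMF (ι → ℕ)), IsLoad M ε A S →
      IsStationary (thresholdStep R A S) π →
      Integrable (fun Q => totalQueue Q ^ (k + 1)) π.toMeasure ∧
        ∫ Q, totalQueue Q ^ (k + 1) ∂π.toMeasure ≤ C / ε ^ (k + 1) := by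
  obtain ⟨C, hC0, hC⟩ := exists_isStationary_moment S M k
  have hN : (0 : ℝ) < Fintype.card ι := by exact_mod_cast Fintype.card_pos
  refine ⟨Fintype.card ι ^ k * C, by positivity, fun ε A R π h hπ => ?_⟩
  have hε := h.eps_pos
  obtain ⟨ρ, hρ, hle⟩ := hC ε A R h
  rw [h.unique hρ hπ] at hle
  have h0 : ∀ Q : ι → ℕ, 0 ≤ ∑ i, (Q i : ℝ) ^ (k + 1) := fun Q => by positivity
  have hi : Integrable (fun Q : ι → ℕ => ∑ i, (Q i : ℝ) ^ (k + 1)) π.toMeasure :=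
    (integrable_iff_of_nonneg h0).2 (ne_top_of_le_ne_top ENNReal.ofReal_ne_top hle)
  have hint : ∫ Q : ι → ℕ, ∑ i, (Q i : ℝ) ^ (k + 1) ∂π.toMeasure ≤ C / ε ^ (k + 1) := by
    rw [integral_of_nonneg h0]
    exact ENNReal.toReal_le_of_le_ofReal (by positivity) hle
  have hpow : ∀ Q : ι → ℕ, totalQueue Q ^ (k + 1)
      ≤ (Fintype.card ι : ℝ) ^ k * ∑ i, (Q i : ℝ) ^ (k + 1) := fun Q => by
    have := pow_sum_div_card_le_sum_pow (s := Finset.univ) (f := fun i => (Q i : ℝ))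
      (fun i _ => Nat.cast_nonneg _) k
    rw [Finset.card_univ, div_le_iff₀ (by positivity)] at this
    rw [totalQueue]; linarith
  have hi' := integrable_of_le (hi.const_mul ((Fintype.card ι : ℝ) ^ k))
    (fun Q => pow_nonneg (totalQueue_nonneg Q) (k + 1)) hpow
  refine ⟨hi', (integral_mono hi' (hi.const_mul _) hpow).trans ?_⟩
  rw [integral_const_mul, mul_div_assoc]
  exact mul_le_mul_of_nonneg_left hint (by positivity)

variable {M R : ℕ} {ε : ℝ} {A : PMF ℕ} {S : PMF (ι → ℕ)} {π : PMF (ι → ℕ)}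

namespace IsLoad

theorem integrable_pow (h : IsLoad M ε A S) (hπ : IsStationary (thresholdStep R A S) π) (k : ℕ) :
    Integrable (fun Q => totalQueue Q ^ (k + 1)) π.toMeasure := by
  obtain ⟨C, -, hC⟩ := exists_moment_bound S M k
  exact (hC ε A R π h hπ).1

theorem integrable_totalQueue (h : IsLoad M ε A S) (hπ : IsStationary (thresholdStep R A S) π) :
    Integrable (totalQueue : (ι → ℕ) → ℝ) π.toMeasure := by
  simpa using h.integrable_pow hπ 0

theorem integrable_imbalance (h : IsLoad M ε A S) (hπ : IsStationary (thresholdStep R A S) π) :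
    Integrable (imbalance R : (ι → ℕ) → ℝ) π.toMeasure :=
  integrable_of_le (h.integrable_totalQueue hπ) (imbalance_nonneg R) (imbalance_le_totalQueue R)

/-- In steady state the mean unused service is the spare capacity `ε`. -/
theorem integral_meanUnused (h : IsLoad M ε A S) (hπ : IsStationary (thresholdStep R A S) π) :
    Integrable (meanUnused M R A S) π.toMeasure ∧
      ∫ Q, meanUnused M R A S Q ∂π.toMeasure = ε := by
  have hi := h.integrable_totalQueue hπ
  obtain ⟨h1, h2⟩ := h.integral_step hπ totalQueue_nonneg hi
  have e : meanUnused M R A S = fun Q =>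
      noiseMean M R A S Q (fun a s n => totalQueue (nextQueue Q a s n)) - totalQueue Q + ε := by
    funext Q; rw [h.noiseMean_totalQueue]; ring
  have i1 : Integrable (fun Q => noiseMean M R A S Q
      (fun a s n => totalQueue (nextQueue Q a s n)) - totalQueue Q) π.toMeasure := h1.sub hi
  rw [e]
  refine ⟨i1.add (integrable_const ε), ?_⟩
  rw [integral_add i1 (integrable_const ε), integral_sub h1 hi, h2]
  simp

theorem integrable_meanCross (h : IsLoad M ε A S) (hπ : IsStationary (thresholdStep R A S) π) :
    Integrable (meanCross M R A S) π.toMeasure := by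
  refine integrable_of_le ((h.integral_step hπ totalQueue_nonneg
    (h.integrable_totalQueue hπ)).1.const_mul (Fintype.card ι * M : ℝ))
    (fun Q => noiseMean_nonneg fun a s n =>
      mul_nonneg (totalQueue_nonneg _) (totalUnused_nonneg _ _ _ _)) fun Q => ?_
  rw [← noiseMean_const_mul]
  refine noiseMean_mono fun a s n _ hs => ?_
  rw [mul_comm]
  exact mul_le_mul_of_nonneg_right (totalUnused_le hs) (totalQueue_nonneg _)

/-- A nonnegative quantity that is at most a multiple of the unused service has mean of order
`ε`. -/
theorem integral_le_of_le_unused (h : IsLoad M ε A S)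
    (hπ : IsStationary (thresholdStep R A S) π) {g : (ι → ℕ) → ℕ → (ι → ℕ) → ι → ℝ} {c : ℝ}
    (h0 : ∀ Q a s n, 0 ≤ g Q a s n)
    (hg : ∀ Q a s n, (∀ i, s i ≤ M) → g Q a s n ≤ c * totalUnused Q a s n) :
    Integrable (fun Q => noiseMean M R A S Q (g Q)) π.toMeasure ∧
      0 ≤ ∫ Q, noiseMean M R A S Q (g Q) ∂π.toMeasure ∧
      ∫ Q, noiseMean M R A S Q (g Q) ∂π.toMeasure ≤ c * ε := by
  obtain ⟨hi, hu⟩ := h.integral_meanUnused hπ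
  have hle : ∀ Q, noiseMean M R A S Q (g Q) ≤ c * meanUnused M R A S Q := fun Q => by
    rw [meanUnused, ← noiseMean_const_mul]
    exact noiseMean_mono fun a s n _ hs => hg Q a s n hs
  have hnn : ∀ Q, 0 ≤ noiseMean M R A S Q (g Q) := fun Q => noiseMean_nonneg (h0 Q)
  have hi' := integrable_of_le (hi.const_mul c) hnn hle
  refine ⟨hi', integral_nonneg hnn, (integral_mono hi' (hi.const_mul c) hle).trans ?_⟩
  rw [integral_const_mul, hu]

/-- The balance equation of the sum of the squared queue lengths: up to terms of order `ε`, the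
total queue length falls short of its value under random routing by the steady-state imbalance. -/
theorem balance_sum_sq (h : IsLoad M ε A S) (hπ : IsStationary (thresholdStep R A S) π) :
    ∃ w, 0 ≤ w ∧ w ≤ M * ε ∧
      2 * (ε / Fintype.card ι) * ∫ Q, totalQueue Q ∂π.toMeasure
        + 2 * (totalServiceRate S - ε) * ∫ Q, imbalance R Q ∂π.toMeasure
      = var A + totalServiceVar S + totalServiceRate S ^ 2 * (1 - 1 / Fintype.card ι)
          + ε ^ 2 - 2 * ε * totalServiceRate S * (1 - 1 / Fintype.card ι) - w := by
  set β := var A + totalServiceVar S + totalServiceRate S ^ 2 * (1 - 1 / Fintype.card ι)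
          + ε ^ 2 - 2 * ε * totalServiceRate S * (1 - 1 / Fintype.card ι) with hβ
  obtain ⟨hw, hw0, hwle⟩ := h.integral_le_of_le_unused hπ
    (g := fun Q a s n => ∑ i, (unusedService Q a s n i : ℝ) ^ 2) (c := M)
    (fun Q a s n => by positivity) (fun Q a s n hs => by
      rw [totalUnused, Finset.mul_sum]
      refine Finset.sum_le_sum fun i _ => ?_
      rw [pow_two]
      exact mul_le_mul_of_nonneg_right
        (Nat.cast_le.2 ((unusedService_le Q a s n i).trans (hs i))) (Nat.cast_nonneg _))
  refine ⟨_, hw0, hwle, ?_⟩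
  have hV0 : ∀ Q : ι → ℕ, 0 ≤ ∑ i, (Q i : ℝ) ^ 2 := fun Q => by positivity
  have hV : Integrable (fun Q : ι → ℕ => ∑ i, (Q i : ℝ) ^ 2) π.toMeasure :=
    integrable_of_le (h.integrable_pow hπ 1) hV0 fun Q =>
      Finset.sum_sq_le_sq_sum_of_nonneg fun i _ => Nat.cast_nonneg _
  have hT := h.integrable_totalQueue hπ
  have hD := h.integrable_imbalance hπ
  have h2 := (h.integral_step hπ hV0 hV).2
  have e : (fun Q => noiseMean M R A S Q (fun a s n => ∑ i, (nextQueue Q a s n i : ℝ) ^ 2))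
      = fun Q => ∑ i, (Q i : ℝ) ^ 2 - 2 * (ε / Fintype.card ι) * totalQueue Q
        - 2 * (totalServiceRate S - ε) * imbalance R Q + β
        - noiseMean M R A S Q (fun a s n => ∑ i, (unusedService Q a s n i : ℝ) ^ 2) := by
    funext Q; rw [h.noiseMean_sum_sq, hβ]
  have i1 : Integrable (fun Q : ι → ℕ => ∑ i, (Q i : ℝ) ^ 2
      - 2 * (ε / Fintype.card ι) * totalQueue Q) π.toMeasure := hV.sub (hT.const_mul _)
  have i2 : Integrable (fun Q : ι → ℕ => ∑ i, (Q i : ℝ) ^ 2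
      - 2 * (ε / Fintype.card ι) * totalQueue Q - 2 * (totalServiceRate S - ε) * imbalance R Q)
      π.toMeasure := i1.sub (hD.const_mul _)
  have i3 : Integrable (fun Q : ι → ℕ => ∑ i, (Q i : ℝ) ^ 2
      - 2 * (ε / Fintype.card ι) * totalQueue Q - 2 * (totalServiceRate S - ε) * imbalance R Q + β)
      π.toMeasure := i2.add (integrable_const β)
  rw [e, integral_sub i3 hw, integral_add i2 (integrable_const β),
    integral_sub i1 (hD.const_mul _), integral_sub hV (hT.const_mul _),
    integral_const_mul, integral_const_mul] at h2
  simp only [integral_const, probReal_univ, one_smul] at h2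
  linarith

/-- The balance equation of the square of the total queue length: up to terms of order `ε`, the
total queue length exceeds that of a single pooled queue by the work that waits while service is
lost. -/
theorem balance_sq_sum (h : IsLoad M ε A S) (hπ : IsStationary (thresholdStep R A S) π) :
    ∃ v, 0 ≤ v ∧ v ≤ Fintype.card ι * M * ε ∧
      2 * ε * ∫ Q, totalQueue Q ∂π.toMeasure
      = var A + totalServiceVar S + ε ^ 2 + 2 * ∫ Q, meanCross M R A S Q ∂π.toMeasure - v := by
  set ζ := var A + totalServiceVar S + ε ^ 2 with hζ
  obtain ⟨hw, hw0, hwle⟩ := h.integral_le_of_le_unused hπ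
    (g := fun Q a s n => totalUnused Q a s n ^ 2) (c := Fintype.card ι * M)
    (fun Q a s n => sq_nonneg _) (fun Q a s n hs => by
      rw [pow_two]
      exact mul_le_mul_of_nonneg_right (totalUnused_le hs) (totalUnused_nonneg _ _ _ _))
  refine ⟨_, hw0, hwle, ?_⟩
  have hV0 : ∀ Q : ι → ℕ, 0 ≤ totalQueue Q ^ 2 := fun Q => sq_nonneg _
  have hV : Integrable (fun Q : ι → ℕ => totalQueue Q ^ 2) π.toMeasure := h.integrable_pow hπ 1
  have hT := h.integrable_totalQueue hπ
  have hX := h.integrable_meanCross hπ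
  have h2 := (h.integral_step hπ hV0 hV).2
  have e : (fun Q => noiseMean M R A S Q (fun a s n => totalQueue (nextQueue Q a s n) ^ 2))
      = fun Q => totalQueue Q ^ 2 - 2 * ε * totalQueue Q + ζ
        + 2 * meanCross M R A S Q - noiseMean M R A S Q (fun a s n => totalUnused Q a s n ^ 2) := by
    funext Q; rw [h.noiseMean_totalQueue_sq]
  have i1 : Integrable (fun Q : ι → ℕ => totalQueue Q ^ 2 - 2 * ε * totalQueue Q) π.toMeasure :=
    hV.sub (hT.const_mul _)
  have i2 : Integrable (fun Q : ι → ℕ => totalQueue Q ^ 2 - 2 * ε * totalQueue Q + ζ)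
      π.toMeasure := i1.add (integrable_const ζ)
  have i3 : Integrable (fun Q : ι → ℕ => totalQueue Q ^ 2 - 2 * ε * totalQueue Q + ζ
      + 2 * meanCross M R A S Q) π.toMeasure := i2.add (hX.const_mul _)
  rw [e, integral_sub i3 hw, integral_add i2 (hX.const_mul _),
    integral_add i1 (integrable_const ζ), integral_sub hV (hT.const_mul _), integral_const_mul,
    integral_const_mul] at h2
  simp only [integral_const, probReal_univ, one_smul] at h2
  linarith

/-- Whenever service is lost some queue is empty, so that the other queues contribute to the
imbalance. -/
theorem integral_meanCross_le (h : IsLoad M ε A S) (hπ : IsStationary (thresholdStep R A S) π)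
    (hR : 1 ≤ R) :
    ∫ Q, meanCross M R A S Q ∂π.toMeasure
      ≤ (Fintype.card ι : ℝ) ^ 2 * M * (∫ Q, imbalance R Q ∂π.toMeasure + R * ε) := by
  have hD := h.integral_step hπ (imbalance_nonneg R) (h.integrable_imbalance hπ)
  have hU := h.integral_meanUnused hπ
  have hle : ∀ Q, meanCross M R A S Q ≤ (Fintype.card ι : ℝ) ^ 2 * M
      * (noiseMean M R A S Q (fun a s n => imbalance R (nextQueue Q a s n))
        + R * meanUnused M R A S Q) := by
    intro Q
    rw [meanUnused, ← noiseMean_const_mul, ← noiseMean_add, ← noiseMean_const_mul]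
    refine noiseMean_mono fun a s n _ hs => ?_
    have hI := imbalance_nonneg R (nextQueue Q a s n)
    by_cases h0 : ∀ i, unusedService Q a s n i = 0
    · have : totalUnused Q a s n = 0 := by simp [totalUnused, h0]
      rw [this]
      simp only [mul_zero, add_zero]
      positivity
    · push Not at h0
      obtain ⟨i, hi⟩ := h0
      have h1 : nextQueue Q a s n i = 0 := by
        rcases mul_eq_zero.1 (nextQueue_mul_unusedService Q a s n i) with h | h
        · exact_mod_cast h
        · exact absurd (by exact_mod_cast h) hi
      have h2 := totalQueue_le_of_lt (R := R) (Q := nextQueue Q a s n) (i := i) (by omega)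
      have h3 : (1 : ℝ) ≤ totalUnused Q a s n := by
        have h4 : (1 : ℝ) ≤ unusedService Q a s n i := by
          exact_mod_cast Nat.one_le_iff_ne_zero.2 hi
        exact h4.trans (Finset.single_le_sum (f := fun i => (unusedService Q a s n i : ℝ))
          (fun _ _ => Nat.cast_nonneg _) (Finset.mem_univ i))
      have h5 : (R : ℝ) ≤ R * totalUnused Q a s n := le_mul_of_one_le_right (Nat.cast_nonneg _) h3
      calc totalQueue (nextQueue Q a s n) * totalUnused Q a s n
          ≤ (Fintype.card ι * (imbalance R (nextQueue Q a s n) + R)) * (Fintype.card ι * M) :=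
            mul_le_mul h2 (totalUnused_le hs) (totalUnused_nonneg _ _ _ _) (by positivity)
        _ = (Fintype.card ι : ℝ) ^ 2 * M * (imbalance R (nextQueue Q a s n) + R) := by ring
        _ ≤ _ := by gcongr
  have i1 : Integrable (fun Q => noiseMean M R A S Q
      (fun a s n => imbalance R (nextQueue Q a s n)) + R * meanUnused M R A S Q) π.toMeasure :=
    hD.1.add (hU.1.const_mul _)
  refine (integral_mono (h.integrable_meanCross hπ) (i1.const_mul _) hle).trans (le_of_eq ?_)
  rw [integral_const_mul, integral_add hD.1 (hU.1.const_mul _), hD.2, integral_const_mul, hU.2]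

/-- The weight `1 + ∑ Q` of the states in which queue `i` is at most `l`. -/
noncomputable def lowQueueWeight (i : ι) (l : ℕ) (Q : ι → ℕ) : ℝ :=
  if Q i ≤ l then 1 + totalQueue Q else 0

theorem lowQueueWeight_nonneg (i : ι) (l : ℕ) (Q : ι → ℕ) : 0 ≤ lowQueueWeight i l Q := by
  unfold lowQueueWeight
  split_ifs
  · linarith [totalQueue_nonneg Q]
  · exact le_rfl

theorem integrable_lowQueueWeight (h : IsLoad M ε A S)
    (hπ : IsStationary (thresholdStep R A S) π) (i : ι) (l : ℕ) :
    Integrable (lowQueueWeight i l : (ι → ℕ) → ℝ) π.toMeasure := by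
  refine integrable_of_le ((integrable_const (1 : ℝ)).add (h.integrable_totalQueue hπ))
    (lowQueueWeight_nonneg i l) fun Q => ?_
  change _ ≤ 1 + totalQueue Q
  unfold lowQueueWeight
  split_ifs
  · exact le_rfl
  · linarith [totalQueue_nonneg Q]

theorem noiseMean_arrival_service_mul (f : ℕ → ℝ) (g : (ι → ℕ) → ℝ) (Q : ι → ℕ) (c : ℝ) :
    noiseMean M R A S Q (fun a s _ => f a * (g s * c))
      = finMean A (Finset.range (M + 1)) f * (finMean S (serviceBox ι M) g * c) := by
  simp only [noiseMean, finMean_const (dispatch_support_subset _), finMean_const_mul,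
    finMean_mul_const]

theorem one_add_totalQueue_le {Q s : ι → ℕ} (a : ℕ) (n : ι) (hs : ∀ i, s i ≤ M) :
    (1 + Fintype.card ι * M : ℝ)⁻¹ * (1 + totalQueue Q) ≤ 1 + totalQueue (nextQueue Q a s n) := by
  have h1 := totalQueue_nextQueue Q a s n
  have h2 := totalUnused_nonneg Q a s n
  have h3 : ∑ i, (s i : ℝ) ≤ Fintype.card ι * M := by
    rw [← nsmul_eq_mul]
    exact Finset.sum_le_card_nsmul _ _ _ fun i _ => Nat.cast_le.2 (hs i)
  have h4 : (0 : ℝ) ≤ a := Nat.cast_nonneg _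
  have h5 := totalQueue_nonneg (nextQueue Q a s n)
  have h6 : (0 : ℝ) ≤ Fintype.card ι * M := by positivity
  rw [inv_mul_le_iff₀ (by positivity)]
  nlinarith

/-- The probability of an empty arrival batch together with nonzero service at server `i`, reduced
by the largest factor by which `1 + ∑ Q` can shrink in one time-slot. -/
noncomputable def drainFactor (M : ℕ) (p : ℝ) (S : PMF (ι → ℕ)) (i : ι) : ℝ :=
  p * (finMean S (serviceBox ι M) fun s => if s i ≠ 0 then 1 else 0)
    * (1 + Fintype.card ι * M : ℝ)⁻¹

theorem drainFactor_pos (h : IsLoad M ε A S) {p : ℝ} (hp : 0 < p) (i : ι) :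
    0 < drainFactor M p S i := by
  obtain ⟨s, hs, hsi⟩ := h.exists_service_ne_zero i
  have h1 : 0 < finMean S (serviceBox ι M) fun s => if s i ≠ 0 then (1 : ℝ) else 0 := by
    refine lt_of_lt_of_le ?_ (single_le_finMean (fun s _ => by split_ifs <;> norm_num)
      (h.service_support ((PMF.mem_support_iff S s).2 hs)))
    rw [if_pos hsi, mul_one]
    exact ENNReal.toReal_pos hs (S.apply_ne_top s)
  unfold drainFactor
  positivity

/-- A lower bound for the mean of `g` over a time-slot that uses only the event that nothing arrives
and server `i` offers service. -/
theorem drainFactor_mul_le {p : ℝ} (hp : p ≤ (A 0).toReal) (i : ι)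
    {Q : ι → ℕ} {b : Prop} [Decidable b] {g : ℕ → (ι → ℕ) → ι → ℝ} (h0 : ∀ a s n, 0 ≤ g a s n)
    (hg : b → ∀ s n, (∀ k, s k ≤ M) → s i ≠ 0 →
      (1 + Fintype.card ι * M : ℝ)⁻¹ * (1 + totalQueue Q) ≤ g 0 s n) :
    drainFactor M p S i * (if b then 1 + totalQueue Q else 0) ≤ noiseMean M R A S Q g := by
  have hT := totalQueue_nonneg Q
  split_ifs with hb
  swap
  · rw [mul_zero]; exact noiseMean_nonneg h0
  have h1 : noiseMean M R A S Q (fun a s _ => (if a = 0 then (1 : ℝ) else 0)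
      * ((if s i ≠ 0 then 1 else 0) * ((1 + Fintype.card ι * M : ℝ)⁻¹ * (1 + totalQueue Q))))
      ≤ noiseMean M R A S Q g := by
    refine noiseMean_mono fun a s n _ hs => ?_
    by_cases ha : a = 0
    · by_cases hsi : s i = 0
      · simpa [hsi] using h0 a s n
      · subst ha
        simpa [hsi] using hg hb s n hs hsi
    · simpa [ha] using h0 a s n
  rw [noiseMean_arrival_service_mul] at h1
  have h2 : finMean A (Finset.range (M + 1)) (fun a => if a = 0 then (1 : ℝ) else 0)
      = (A 0).toReal := by simp [finMean]
  rw [h2] at h1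
  refine le_trans (le_of_eq_of_le ?_ (mul_le_mul_of_nonneg_right hp ?_)) h1
  · rw [drainFactor]; ring
  · exact mul_nonneg (finMean_nonneg fun s _ => by split_ifs <;> norm_num) (by positivity)

theorem drainFactor_mul_integral_zero (h : IsLoad M ε A S)
    (hπ : IsStationary (thresholdStep R A S) π) {p : ℝ} (hp : p ≤ (A 0).toReal) (i : ι) :
    drainFactor M p S i * ∫ Q, lowQueueWeight i 0 Q ∂π.toMeasure
      ≤ ε + ∫ Q, meanCross M R A S Q ∂π.toMeasure := by
  obtain ⟨hUi, hU⟩ := h.integral_meanUnused hπ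
  have hX := h.integrable_meanCross hπ
  have hi := h.integrable_lowQueueWeight hπ i 0
  rw [← integral_const_mul, ← hU, ← integral_add hUi hX]
  refine integral_mono (hi.const_mul _) (hUi.add hX) fun Q => ?_
  change _ ≤ meanUnused M R A S Q + meanCross M R A S Q
  rw [meanUnused, meanCross, ← noiseMean_add]
  refine drainFactor_mul_le hp i (fun a s n => ?_) fun hQ s n hs hsi => ?_
  · exact add_nonneg (totalUnused_nonneg _ _ _ _)
      (mul_nonneg (totalQueue_nonneg _) (totalUnused_nonneg _ _ _ _))
  · refine (one_add_totalQueue_le 0 n hs).trans ?_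
    have h1 : (1 : ℝ) ≤ totalUnused Q 0 s n := by
      have h2 : (1 : ℝ) ≤ unusedService Q 0 s n i := by
        have : 1 ≤ unusedService Q 0 s n i := by
          simp only [unusedService, ite_self]; omega
        exact_mod_cast this
      exact h2.trans (Finset.single_le_sum (f := fun i => (unusedService Q 0 s n i : ℝ))
        (fun _ _ => Nat.cast_nonneg _) (Finset.mem_univ i))
    have h3 := totalQueue_nonneg (nextQueue Q 0 s n)
    nlinarith

theorem drainFactor_mul_integral_succ (h : IsLoad M ε A S)
    (hπ : IsStationary (thresholdStep R A S) π) {p : ℝ} (hp : p ≤ (A 0).toReal) (i : ι) (l : ℕ) :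
    drainFactor M p S i * ∫ Q, lowQueueWeight i (l + 1) Q ∂π.toMeasure
      ≤ ∫ Q, lowQueueWeight i l Q ∂π.toMeasure := by
  have hi := h.integrable_lowQueueWeight hπ i (l + 1)
  obtain ⟨h1, h2⟩ := h.integral_step hπ (lowQueueWeight_nonneg i l)
    (h.integrable_lowQueueWeight hπ i l)
  rw [← integral_const_mul, ← h2]
  refine integral_mono (hi.const_mul _) h1 fun Q => ?_
  refine drainFactor_mul_le hp i (fun a s n => lowQueueWeight_nonneg _ _ _) fun hQ s n hs hsi => ?_
  have h3 : nextQueue Q 0 s n i ≤ l := by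
    simp only [nextQueue, ite_self]; omega
  rw [lowQueueWeight, if_pos h3]
  exact one_add_totalQueue_le 0 n hs

/-- Starting from a state in which queue `i` is low, a stretch of slots without arrivals leads with
a probability that does not vanish to unused service at server `i`, while the total queue length
shrinks at most by a constant factor. -/
theorem drainFactor_pow_mul_integral_le (h : IsLoad M ε A S)
    (hπ : IsStationary (thresholdStep R A S) π) {p : ℝ} (hp0 : 0 < p) (hp : p ≤ (A 0).toReal)
    (i : ι) (l : ℕ) :
    drainFactor M p S i ^ (l + 1) * ∫ Q, lowQueueWeight i l Q ∂π.toMeasure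
      ≤ ε + ∫ Q, meanCross M R A S Q ∂π.toMeasure := by
  induction l with
  | zero => simpa using h.drainFactor_mul_integral_zero hπ hp i
  | succ l ih =>
    refine le_trans ?_ ih
    rw [pow_succ, mul_assoc]
    exact mul_le_mul_of_nonneg_left (h.drainFactor_mul_integral_succ hπ hp i l)
      (pow_nonneg (h.drainFactor_pos hp0 i).le _)

theorem integral_imbalance_le (h : IsLoad M ε A S)
    (hπ : IsStationary (thresholdStep R A S) π) {p : ℝ} (hp0 : 0 < p) (hp : p ≤ (A 0).toReal) :
    ∫ Q, imbalance R Q ∂π.toMeasure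
      ≤ (∑ i, (drainFactor M p S i ^ (R + 1))⁻¹)
        * (ε + ∫ Q, meanCross M R A S Q ∂π.toMeasure) := by
  have hi := fun i => h.integrable_lowQueueWeight hπ i R
  have h1 : ∫ Q, imbalance R Q ∂π.toMeasure ≤ ∫ Q, ∑ i, lowQueueWeight i R Q ∂π.toMeasure := by
    refine integral_mono (h.integrable_imbalance hπ) (integrable_finsetSum _ fun i _ => hi i)
      fun Q => ?_
    rcases (shortQueues R Q).eq_empty_or_nonempty with hm | ⟨i, hm⟩
    · rw [imbalance_eq_zero_of_empty hm]
      exact Finset.sum_nonneg fun i _ => lowQueueWeight_nonneg i R Q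
    · refine le_trans ?_ (Finset.single_le_sum (f := fun i => lowQueueWeight i R Q)
        (fun i _ => lowQueueWeight_nonneg i R Q) (Finset.mem_univ i))
      simp only [lowQueueWeight, if_pos (mem_shortQueues.1 hm).le]
      linarith [imbalance_le_totalQueue R Q]
  refine h1.trans ?_
  rw [integral_finsetSum _ fun i _ => hi i, Finset.sum_mul]
  refine Finset.sum_le_sum fun i _ => ?_
  rw [le_inv_mul_iff₀ (pow_pos (h.drainFactor_pos hp0 i) _)]
  exact h.drainFactor_pow_mul_integral_le hπ hp0 hp i R

/-- For a large threshold, an imbalance requires a queue of at least that length. -/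
theorem pow_mul_integral_imbalance_le (h : IsLoad M ε A S)
    (hπ : IsStationary (thresholdStep R A S) π) (k : ℕ) :
    (R : ℝ) ^ k * ∫ Q, imbalance R Q ∂π.toMeasure ≤ ∫ Q, totalQueue Q ^ (k + 1) ∂π.toMeasure := by
  rw [← integral_const_mul]
  refine integral_mono ((h.integrable_imbalance hπ).const_mul _) (h.integrable_pow hπ k)
    fun Q => ?_
  by_cases hQ : ∀ i, Q i < R
  · simp only [imbalance_eq_zero_of_lt hQ, mul_zero]
    exact pow_nonneg (totalQueue_nonneg Q) _
  · push Not at hQ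
    obtain ⟨i, hi⟩ := hQ
    have h1 : (R : ℝ) ≤ totalQueue Q := le_trans (Nat.cast_le.2 hi)
      (Finset.single_le_sum (f := fun i => (Q i : ℝ)) (fun _ _ => Nat.cast_nonneg _)
        (Finset.mem_univ i))
    rw [pow_succ]
    exact mul_le_mul (pow_le_pow_left₀ (Nat.cast_nonneg _) h1 k) (imbalance_le_totalQueue R Q)
      (imbalance_nonneg R Q) (pow_nonneg (totalQueue_nonneg Q) _)

end IsLoad

end Identities

/-! ### Heavy-traffic limits -/

section HeavyTraffic

variable {ι : Type*} [Fintype ι] [DecidableEq ι] [Nonempty ι]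

/-- The heavy-traffic limit of the scaled total queue length under random routing, when the limit
of the arrival variance is `σsq`. -/
noncomputable def randomRoutingLimit (S : PMF (ι → ℕ)) (σsq : ℝ) : ℝ :=
  Fintype.card ι / 2
    * (σsq + totalServiceVar S + totalServiceRate S ^ 2 * (1 - 1 / Fintype.card ι))

theorem totalServiceVar_nonneg (S : PMF (ι → ℕ)) : 0 ≤ totalServiceVar S :=
  Finset.sum_nonneg fun _ _ => variance_nonneg _ _

theorem half_lt_randomRoutingLimit [Nontrivial ι] {S : PMF (ι → ℕ)} (hS : 0 < totalServiceRate S)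
    {σsq : ℝ} (hσ : 0 ≤ σsq) :
    (σsq + totalServiceVar S) / 2 < randomRoutingLimit S σsq := by
  have hN : (2 : ℝ) ≤ Fintype.card ι := by exact_mod_cast Fintype.one_lt_card (α := ι)
  have hV := totalServiceVar_nonneg S
  have h1 : (1 : ℝ) / Fintype.card ι ≤ 1 / 2 := one_div_le_one_div_of_le two_pos hN
  have h2 : 0 < totalServiceRate S ^ 2 * (1 - 1 / Fintype.card ι) :=
    mul_pos (pow_pos hS 2) (by linarith)
  rw [randomRoutingLimit]
  nlinarith

theorem scaledMean_eq {q : ℝ → PMF (ι → ℕ)} {ε : ℝ} (hε : 0 < ε)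
    (hi : Integrable (totalQueue : (ι → ℕ) → ℝ) (q ε).toMeasure) :
    scaledMean q ε = ENNReal.ofReal (ε * ∫ Q, totalQueue Q ∂(q ε).toMeasure) := by
  have h1 : meanTotalQueue (q ε) = ∑' Q, q ε Q * ENNReal.ofReal (totalQueue Q) := by
    refine tsum_congr fun Q => ?_
    rw [totalQueue, ENNReal.ofReal_sum_of_nonneg fun _ _ => Nat.cast_nonneg _]
    simp
  rw [scaledMean, h1, ENNReal.ofReal_mul hε.le, integral_of_nonneg totalQueue_nonneg,
    ENNReal.ofReal_toReal ((integrable_iff_of_nonneg totalQueue_nonneg).1 hi)]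

/-- In steady state under JBT the queue lengths form a stationary chain of their own: by uniqueness
the steady state is the one in which the memory consists exactly of the short queues. -/
theorem isStationary_map_fst {M : ℕ} {ε r : ℝ} {A : PMF ℕ} {S : PMF (ι → ℕ)} {π : PMF (State ι)}
    (h : IsLoad M ε A S) (hr : 0 < r) (hπ : IsStationary (jbtStep r A S) π) :
    IsStationary (thresholdStep ⌈r⌉₊ A S) (π.map Prod.fst) := by
  obtain ⟨C, -, hC⟩ := exists_isStationary_moment S M 0
  obtain ⟨ρ, hρ, -⟩ := hC ε A ⌈r⌉₊ h
  have h1 : (π.map Prod.fst) = ρ := by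
    rw [h.jbt_unique hr hπ (isStationary_map_consistentState hρ), PMF.map_comp]
    exact PMF.map_id ρ
  rwa [h1]

theorem tendsto_self_nhdsGT : Tendsto (fun ε : ℝ => ε) (𝓝[>] 0) (𝓝 0) :=
  tendsto_nhdsWithin_of_tendsto_nhds tendsto_id

theorem tendsto_of_sub_mul_le {f g : ℝ → ℝ} {a c : ℝ} (hg : Tendsto g (𝓝[>] 0) (𝓝 a))
    (h : ∀ᶠ ε in 𝓝[>] (0 : ℝ), g ε - c * ε ≤ f ε ∧ f ε ≤ g ε) : Tendsto f (𝓝[>] 0) (𝓝 a) := by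
  have h1 : Tendsto (fun ε => g ε - c * ε) (𝓝[>] 0) (𝓝 a) := by
    simpa using hg.sub (tendsto_self_nhdsGT.const_mul c)
  exact tendsto_of_tendsto_of_tendsto_of_le_of_le' h1 hg (h.mono fun _ h => h.1)
    (h.mono fun _ h => h.2)

variable {S : PMF (ι → ℕ)} {A : ℝ → PMF ℕ} {M : ℕ} {σsq : ℝ} {R : ℝ → ℕ} {q : ℝ → PMF (ι → ℕ)}

/-- The heavy-traffic form of `IsLoad.balance_sum_sq`. -/
theorem tendsto_add_imbalance
    (hload : ∀ᶠ ε in 𝓝[>] 0, IsLoad M ε (A ε) S)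
    (hA_var : Tendsto (fun ε => var (A ε)) (𝓝[>] 0) (𝓝 σsq))
    (hq : ∀ᶠ ε in 𝓝[>] 0, IsStationary (thresholdStep (R ε) (A ε) S) (q ε)) :
    Tendsto (fun ε => ε * ∫ Q, totalQueue Q ∂(q ε).toMeasure
        + Fintype.card ι * (totalServiceRate S - ε) * ∫ Q, imbalance (R ε) Q ∂(q ε).toMeasure)
      (𝓝[>] 0) (𝓝 (randomRoutingLimit S σsq)) := by
  have hN : (0 : ℝ) < Fintype.card ι := by exact_mod_cast Fintype.card_pos
  have hg : Tendsto (fun ε => Fintype.card ι / 2 * (var (A ε) + totalServiceVar S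
      + totalServiceRate S ^ 2 * (1 - 1 / Fintype.card ι)
      + ε ^ 2 - 2 * ε * totalServiceRate S * (1 - 1 / Fintype.card ι)))
      (𝓝[>] 0) (𝓝 (randomRoutingLimit S σsq)) := by
    have hε := tendsto_self_nhdsGT
    have := ((((hA_var.add_const (totalServiceVar S)).add_const
      (totalServiceRate S ^ 2 * (1 - 1 / Fintype.card ι))).add (hε.pow 2)).sub
      (((hε.const_mul 2).mul_const (totalServiceRate S)).mul_const
        (1 - 1 / (Fintype.card ι : ℝ)))).const_mul ((Fintype.card ι : ℝ) / 2)
    simpa [randomRoutingLimit] using this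
  refine tendsto_of_sub_mul_le (c := Fintype.card ι / 2 * M) hg ?_
  filter_upwards [hload, hq] with ε h hπ
  obtain ⟨w, hw0, hwM, hw⟩ := h.balance_sum_sq hπ
  -- The balance equation, multiplied by `N / 2`.
  have e : ε * ∫ Q, totalQueue Q ∂(q ε).toMeasure + Fintype.card ι * (totalServiceRate S - ε)
        * ∫ Q, imbalance (R ε) Q ∂(q ε).toMeasure
      = Fintype.card ι / 2 * (2 * (ε / Fintype.card ι) * ∫ Q, totalQueue Q ∂(q ε).toMeasure
        + 2 * (totalServiceRate S - ε) * ∫ Q, imbalance (R ε) Q ∂(q ε).toMeasure) := by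
    field_simp
  rw [e, hw]
  constructor <;> nlinarith

/-- The heavy-traffic form of `IsLoad.balance_sq_sum`. -/
theorem tendsto_sub_cross
    (hload : ∀ᶠ ε in 𝓝[>] 0, IsLoad M ε (A ε) S)
    (hA_var : Tendsto (fun ε => var (A ε)) (𝓝[>] 0) (𝓝 σsq))
    (hq : ∀ᶠ ε in 𝓝[>] 0, IsStationary (thresholdStep (R ε) (A ε) S) (q ε)) :
    Tendsto (fun ε => ε * ∫ Q, totalQueue Q ∂(q ε).toMeasure
        - ∫ Q, meanCross M (R ε) (A ε) S Q ∂(q ε).toMeasure)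
      (𝓝[>] 0) (𝓝 ((σsq + totalServiceVar S) / 2)) := by
  have hg : Tendsto (fun ε => (var (A ε) + totalServiceVar S + ε ^ 2) / 2)
      (𝓝[>] 0) (𝓝 ((σsq + totalServiceVar S) / 2)) := by
    have := ((hA_var.add_const (totalServiceVar S)).add (tendsto_self_nhdsGT.pow 2)).div_const 2
    simpa using this
  refine tendsto_of_sub_mul_le (c := Fintype.card ι * M / 2) hg ?_
  filter_upwards [hload, hq] with ε h hπ
  obtain ⟨v, hv0, hvM, hv⟩ := h.balance_sq_sum hπ
  constructor <;> linarith

theorem tendsto_scaledMean_of_imbalance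
    (hload : ∀ᶠ ε in 𝓝[>] 0, IsLoad M ε (A ε) S)
    (hA_var : Tendsto (fun ε => var (A ε)) (𝓝[>] 0) (𝓝 σsq))
    (hq : ∀ᶠ ε in 𝓝[>] 0, IsStationary (thresholdStep (R ε) (A ε) S) (q ε))
    (hD : Tendsto (fun ε => ∫ Q, imbalance (R ε) Q ∂(q ε).toMeasure) (𝓝[>] 0) (𝓝 0)) :
    Tendsto (scaledMean q) (𝓝[>] 0) (𝓝 (ENNReal.ofReal (randomRoutingLimit S σsq))) := by
  have h1 := (tendsto_add_imbalance hload hA_var hq).sub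
    (((tendsto_self_nhdsGT.const_sub (totalServiceRate S)).const_mul (Fintype.card ι : ℝ)).mul hD)
  simp only [mul_zero, sub_zero, add_sub_cancel_right] at h1
  refine (ENNReal.tendsto_ofReal h1).congr' ?_
  filter_upwards [hload, hq] with ε h hπ
  exact (scaledMean_eq h.eps_pos (h.integrable_totalQueue hπ)).symm

/-- With a constant threshold neither the imbalance nor the work that waits while service is lost
can vanish in the limit: each controls the other, and their weighted sum tends to the positive gap
between random routing and a pooled queue. -/
theorem exists_strict_bounds [Nontrivial ι] (hS : 0 < totalServiceRate S)
    (hload : ∀ᶠ ε in 𝓝[>] 0, IsLoad M ε (A ε) S)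
    (hA_var : Tendsto (fun ε => var (A ε)) (𝓝[>] 0) (𝓝 σsq)) (hσ : 0 ≤ σsq)
    {p : ℝ} (hp : 0 < p) (hA : ∀ᶠ ε in 𝓝[>] 0, p ≤ (A ε 0).toReal) {R : ℕ} (hR : 1 ≤ R)
    (hq : ∀ᶠ ε in 𝓝[>] 0, IsStationary (thresholdStep R (A ε) S) (q ε)) :
    ∃ δ > 0, ∀ᶠ ε in 𝓝[>] 0,
      (σsq + totalServiceVar S) / 2 + δ ≤ ε * ∫ Q, totalQueue Q ∂(q ε).toMeasure ∧
      ε * ∫ Q, totalQueue Q ∂(q ε).toMeasure ≤ randomRoutingLimit S σsq - δ := by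
  have hy := tendsto_add_imbalance hload hA_var hq
  have hz := tendsto_sub_cross hload hA_var hq
  have hgap := half_lt_randomRoutingLimit hS hσ
  have hN : (0 : ℝ) < Fintype.card ι := by exact_mod_cast Fintype.card_pos
  set L := randomRoutingLimit S σsq
  set Z := (σsq + totalServiceVar S) / 2
  set μ := totalServiceRate S
  set N : ℝ := ((Fintype.card ι : ℕ) : ℝ)
  set c₁ : ℝ := N ^ 2 * M with hc₁
  set c₂ : ℝ := ∑ i, (IsLoad.drainFactor M p S i ^ (R + 1))⁻¹ with hc₂
  obtain ⟨ε₀, hε₀⟩ := hload.exists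
  have hc₁0 : 0 ≤ c₁ := by positivity
  have hc₂0 : 0 ≤ c₂ := Finset.sum_nonneg fun i _ =>
    inv_nonneg.2 (pow_nonneg (hε₀.drainFactor_pos hp i).le _)
  set Δ := L - Z with hΔ
  have hΔ0 : 0 < Δ := sub_pos.2 hgap
  -- The lower bounds for `X` and `D` below: `X + N μ D` is eventually above `Δ / 2`, and the terms
  -- of order `ε` cost at most `Δ / 4`.
  set η₁ := Δ / 4 / (1 + N * μ * c₂) with hη₁
  set η₂ := Δ / 4 / (c₁ + N * μ) with hη₂
  have hη₁0 : 0 < η₁ := by positivity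
  have hη₂0 : 0 < η₂ := by positivity
  set δ := min (η₁ / 2) (N * μ / 2 * η₂ / 2) with hδ
  have hδ0 : 0 < δ := lt_min (by positivity) (by positivity)
  refine ⟨δ, hδ0, ?_⟩
  have hsmall : ∀ c d : ℝ, 0 < d → ∀ᶠ ε in 𝓝[>] (0 : ℝ), c * ε < d := fun c d hd => by
    have := tendsto_self_nhdsGT.const_mul c
    rw [mul_zero] at this
    exact this.eventually_lt_const hd
  filter_upwards [hload, hq, hA, hy.eventually_lt_const (show L < L + δ by linarith),
    hz.eventually_const_lt (show Z - δ < Z by linarith),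
    (hy.sub hz).eventually_const_lt (show Δ / 2 < Δ by linarith),
    hsmall (N * μ * c₂) (Δ / 4) (by linarith), hsmall (c₁ * R) (Δ / 4) (by linarith),
    hsmall 1 (μ / 2) (by linarith)] with ε h hπ hAε hyε hzε hyz hs1 hs2 hs3
  have hXle := h.integral_meanCross_le hπ hR
  have hDle := h.integral_imbalance_le hπ hp hAε
  have hD0 : 0 ≤ ∫ Q, imbalance R Q ∂(q ε).toMeasure := integral_nonneg (imbalance_nonneg R)
  have hX0 : 0 ≤ ∫ Q, meanCross M R (A ε) S Q ∂(q ε).toMeasure := integral_nonneg fun Q =>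
    noiseMean_nonneg fun a s n => mul_nonneg (totalQueue_nonneg _) (totalUnused_nonneg _ _ _ _)
  have hε := h.eps_pos
  set X := ∫ Q, meanCross M R (A ε) S Q ∂(q ε).toMeasure
  set D := ∫ Q, imbalance R Q ∂(q ε).toMeasure
  set T := ∫ Q, totalQueue Q ∂(q ε).toMeasure
  have hND : N * (μ - ε) * D ≤ N * μ * D := by
    have : 0 ≤ N * ε * D := by positivity
    nlinarith
  have hX : η₁ ≤ X := by
    rw [hη₁, div_le_iff₀ (by positivity)]
    have := mul_le_mul_of_nonneg_left hDle (by positivity : 0 ≤ N * μ)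
    nlinarith
  have hD : η₂ ≤ D := by
    rw [hη₂, div_le_iff₀ (by positivity)]
    nlinarith
  have hδ1 : δ ≤ η₁ / 2 := min_le_left _ _
  have hδ2 : δ ≤ N * μ / 2 * η₂ / 2 := min_le_right _ _
  have hND' : N * μ / 2 * η₂ ≤ N * (μ - ε) * D := by
    have h1 : N * μ / 2 ≤ N * (μ - ε) := by nlinarith
    exact mul_le_mul h1 hD hη₂0.le (by nlinarith)
  constructor <;> linarith

/-- A threshold that grows faster than the queue lengths makes the imbalance vanish. -/
theorem tendsto_imbalance_of_threshold {α : ℝ} (hα : 0 < α)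
    (hload : ∀ᶠ ε in 𝓝[>] 0, IsLoad M ε (A ε) S)
    (hR : ∀ᶠ ε in 𝓝[>] (0 : ℝ), (1 / ε) ^ (1 + α) ≤ R ε)
    (hq : ∀ᶠ ε in 𝓝[>] 0, IsStationary (thresholdStep (R ε) (A ε) S) (q ε)) :
    Tendsto (fun ε => ∫ Q, imbalance (R ε) Q ∂(q ε).toMeasure) (𝓝[>] 0) (𝓝 0) := by
  obtain ⟨k, hk⟩ := exists_nat_gt (1 / α)
  have hk' : 0 < α * k - 1 := by
    rw [div_lt_iff₀ hα] at hk; linarith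
  obtain ⟨C, hC0, hC⟩ := exists_moment_bound S M k
  have hlim : Tendsto (fun ε : ℝ => C * ε ^ (α * k - 1)) (𝓝[>] 0) (𝓝 0) := by
    have h1 := ((Real.continuousAt_rpow_const 0 (α * k - 1) (Or.inr hk'.le)).tendsto.mono_left
      (nhdsWithin_le_nhds (s := Set.Ioi 0))).const_mul C
    rwa [Real.zero_rpow hk'.ne', mul_zero] at h1
  refine tendsto_of_tendsto_of_tendsto_of_le_of_le' tendsto_const_nhds hlim
    (Eventually.of_forall fun ε => integral_nonneg (imbalance_nonneg _)) ?_
  filter_upwards [hload, hR, hq] with ε h hRε hπ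
  have hε := h.eps_pos
  have hD0 : 0 ≤ ∫ Q, imbalance (R ε) Q ∂(q ε).toMeasure := integral_nonneg (imbalance_nonneg _)
  have h1 := (h.pow_mul_integral_imbalance_le hπ k).trans (hC ε (A ε) (R ε) (q ε) h hπ).2
  have h2 : ((1 / ε) ^ (1 + α)) ^ k = (ε ^ k)⁻¹ * (ε ^ (α * k))⁻¹ := by
    rw [← Real.rpow_natCast, ← Real.rpow_mul (by positivity), add_mul, one_mul,
      Real.rpow_add (by positivity), one_div, Real.inv_rpow hε.le, Real.inv_rpow hε.le,
      Real.rpow_natCast]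
  have h3 : (ε ^ k)⁻¹ * (ε ^ (α * k))⁻¹ * ∫ Q, imbalance (R ε) Q ∂(q ε).toMeasure
      ≤ C / ε ^ (k + 1) := by
    rw [← h2]
    exact le_trans (mul_le_mul_of_nonneg_right
      (pow_le_pow_left₀ (by positivity) hRε k) hD0) h1
  rw [Real.rpow_sub_one hε.ne']
  have h4 : 0 < ε ^ (α * k) := Real.rpow_pos_of_pos hε _
  have h5 : 0 < ε ^ k := pow_pos hε k
  rw [← mul_inv, inv_mul_le_iff₀ (by positivity)] at h3
  refine h3.trans (le_of_eq ?_)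
  rw [pow_succ]; field_simp

end HeavyTraffic

end LoadBalancing

theorem theorem1 {ι : Type*} [Fintype ι] [DecidableEq ι] [Nontrivial ι]
    -- joint law of the services of all servers, and arrival law of the system with parameter `ε`
    (S : PMF (ι → ℕ)) (A : ℝ → PMF ℕ)
    -- the services are bounded, independent across servers, with equal positive rates
    (hS_bdd : ∃ Smax : ℕ, ∀ s ∈ S.support, ∀ n, s n ≤ Smax)
    (hS_indep : iIndepFun (fun (n : ι) (s : ι → ℕ) => s n) S.toMeasure)
    (hS_hom : ∀ i j, mean (serviceLaw S i) = mean (serviceLaw S j))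
    (hS_pos : 0 < totalServiceRate S)
    -- the arrivals are bounded, vanish with positive probability, and have the heavy-traffic rate
    (hA_bdd : ∃ Amax : ℕ, ∀ ε ∈ Set.Ioo 0 (totalServiceRate S), ∀ k ∈ (A ε).support, k ≤ Amax)
    (hA_zero : ∀ ε ∈ Set.Ioo 0 (totalServiceRate S), 0 < A ε 0)
    (hA_mean : ∀ ε ∈ Set.Ioo 0 (totalServiceRate S), mean (A ε) = totalServiceRate S - ε)
    (σsq : ℝ) (hA_var : Tendsto (fun ε => var (A ε)) (𝓝[>] 0) (𝓝 σsq)) :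
    -- the steady states exist and are unique
    (∀ ε ∈ Set.Ioo 0 (totalServiceRate S), ∃! ρ, IsStationary (randStep (A ε) S) ρ) ∧
    (∀ ε ∈ Set.Ioo 0 (totalServiceRate S), ∀ r : ℝ, 0 < r →
      ∃! π, IsStationary (jbtStep r (A ε) S) π) ∧
    ∀ ρ : ℝ → PMF (ι → ℕ),
      (∀ ε ∈ Set.Ioo 0 (totalServiceRate S), IsStationary (randStep (A ε) S) (ρ ε)) →
      -- `L` is the heavy-traffic limit under random routing
      ∃ L : ℝ≥0, Tendsto (scaledMean ρ) (𝓝[>] 0) (𝓝 (L : ℝ≥0∞)) ∧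
        -- constant threshold
        ((∃ p : ℝ≥0∞, 0 < p ∧ ∀ᶠ ε in 𝓝[>] 0, p ≤ A ε 0) →
          ∀ r : ℝ, 1 ≤ r → ∀ π : ℝ → PMF (State ι),
            (∀ ε ∈ Set.Ioo 0 (totalServiceRate S), IsStationary (jbtStep r (A ε) S) (π ε)) →
            ENNReal.ofReal ((σsq + totalServiceVar S) / 2)
                < liminf (scaledMean fun ε => (π ε).map Prod.fst) (𝓝[>] 0) ∧
              ¬ HeavyTrafficDelayOptimal (σsq + totalServiceVar S)
                  (fun ε => (π ε).map Prod.fst) ∧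
              limsup (scaledMean fun ε => (π ε).map Prod.fst) (𝓝[>] 0) < (L : ℝ≥0∞)) ∧
        -- threshold `(1 / ε) ^ (1 + α)`
        (∀ α : ℝ, 0 < α → ∀ π : ℝ → PMF (State ι),
          (∀ ε ∈ Set.Ioo 0 (totalServiceRate S),
            IsStationary (jbtStep ((1 / ε) ^ (1 + α)) (A ε) S) (π ε)) →
          Tendsto (scaledMean fun ε => (π ε).map Prod.fst) (𝓝[>] 0) (𝓝 (L : ℝ≥0∞))) := by
  obtain ⟨Smax, hSmax⟩ := hS_bdd
  obtain ⟨Amax, hAmax⟩ := hA_bdd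
  have hN : (0 : ℝ) < Fintype.card ι := by exact_mod_cast Fintype.card_pos
  have hload : ∀ ε ∈ Set.Ioo 0 (totalServiceRate S), IsLoad (max Smax Amax) ε (A ε) S := by
    intro ε hε
    refine ⟨fun k hk => ?_, fun s hs => ?_, hS_indep, fun i => ?_, hε.1, hε.2, hA_mean ε hε,
      (hA_zero ε hε).ne'⟩
    · rw [Finset.mem_coe, Finset.mem_range, Nat.lt_succ_iff]
      exact (hAmax ε hε k hk).trans (le_max_right _ _)
    · rw [Finset.mem_coe, mem_serviceBox]
      exact fun i => (hSmax s hs i).trans (le_max_left _ _)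
    · rw [totalServiceRate, Finset.sum_congr rfl fun j _ => hS_hom j i, Finset.sum_const,
        Finset.card_univ, nsmul_eq_mul]
      field_simp
  have hIoo : ∀ᶠ ε in 𝓝[>] (0 : ℝ), ε ∈ Set.Ioo 0 (totalServiceRate S) := Ioo_mem_nhdsGT hS_pos
  have hload' := hIoo.mono hload
  have hσ : 0 ≤ σsq := ge_of_tendsto' hA_var fun ε => variance_nonneg _ _
  have hexists : ∀ ε ∈ Set.Ioo 0 (totalServiceRate S), ∀ R,
      ∃ ρ, IsStationary (thresholdStep R (A ε) S) ρ := fun ε hε R => by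
    obtain ⟨C, -, hC⟩ := exists_isStationary_moment S (max Smax Amax) 0
    obtain ⟨ρ, hρ, -⟩ := hC ε (A ε) R (hload ε hε)
    exact ⟨ρ, hρ⟩
  refine ⟨fun ε hε => ?_, fun ε hε r hr => ?_, fun ρ hρ => ?_⟩
  · rw [randStep_eq_thresholdStep]
    obtain ⟨ρ, hρ⟩ := hexists ε hε 0
    exact ⟨ρ, hρ, fun ρ' hρ' => (hload ε hε).unique hρ' hρ⟩
  · obtain ⟨ρ, hρ⟩ := hexists ε hε ⌈r⌉₊
    have h := isStationary_map_consistentState hρ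
    exact ⟨_, h, fun ρ' hρ' => (hload ε hε).jbt_unique hr hρ' h⟩
  have hL0 : 0 ≤ randomRoutingLimit S σsq := by
    have h1 := half_lt_randomRoutingLimit hS_pos hσ
    have h2 := totalServiceVar_nonneg S
    linarith
  have hL : ((Real.toNNReal (randomRoutingLimit S σsq) : ℝ≥0) : ℝ≥0∞)
      = ENNReal.ofReal (randomRoutingLimit S σsq) := rfl
  refine ⟨Real.toNNReal (randomRoutingLimit S σsq), ?_, ?_, ?_⟩
  · rw [hL]
    refine tendsto_scaledMean_of_imbalance (R := fun _ => 0) hload' hA_var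
      (hIoo.mono fun ε hε => randStep_eq_thresholdStep (A ε) S ▸ hρ ε hε) ?_
    -- Under random routing there is no short queue to favour.
    have h0 : ∀ Q : ι → ℕ, imbalance 0 Q = 0 := fun Q =>
      imbalance_eq_zero_of_empty (by simp [shortQueues])
    simp only [h0, integral_zero, tendsto_const_nhds]
  · rintro ⟨p, hp, hpA⟩ r hr π hπ
    have hq : ∀ᶠ ε in 𝓝[>] (0 : ℝ),
        IsStationary (thresholdStep ⌈r⌉₊ (A ε) S) ((π ε).map Prod.fst) :=
      hIoo.mono fun ε hε => isStationary_map_fst (hload ε hε) (by linarith) (hπ ε hε)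
    obtain ⟨ε₀, hε₀⟩ := hpA.exists
    have hptop : p ≠ ∞ := ne_top_of_le_ne_top ((A ε₀).apply_ne_top 0) hε₀
    obtain ⟨δ, hδ, hbd⟩ := exists_strict_bounds (q := fun ε => (π ε).map Prod.fst) hS_pos hload'
      hA_var hσ (ENNReal.toReal_pos hp.ne' hptop)
      (hpA.mono fun ε h => ENNReal.toReal_mono ((A ε).apply_ne_top 0) h)
      (Nat.one_le_ceil_iff.2 (by linarith)) hq
    have hV := totalServiceVar_nonneg S
    have heq : ∀ᶠ ε in 𝓝[>] (0 : ℝ), scaledMean (fun ε => (π ε).map Prod.fst) ε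
        = ENNReal.ofReal (ε * ∫ Q, totalQueue Q ∂((π ε).map Prod.fst).toMeasure) := by
      filter_upwards [hload', hq] with ε h hπ
      exact scaledMean_eq (q := fun ε => (π ε).map Prod.fst) h.eps_pos (h.integrable_totalQueue hπ)
    have hlow : ENNReal.ofReal ((σsq + totalServiceVar S) / 2)
        < liminf (scaledMean fun ε => (π ε).map Prod.fst) (𝓝[>] 0) := by
      refine lt_of_lt_of_le ((ENNReal.ofReal_lt_ofReal_iff (by linarith)).2
        (lt_add_of_pos_right _ hδ)) (le_liminf_of_le (by isBoundedDefault) ?_)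
      filter_upwards [hbd, heq] with ε h1 h2
      rw [h2]
      exact ENNReal.ofReal_le_ofReal h1.1
    refine ⟨hlow, fun hopt => ?_, ?_⟩
    · exact absurd (hlow.trans_le (le_trans liminf_le_limsup hopt)) (lt_irrefl _)
    · have hgap : 0 < randomRoutingLimit S σsq := by
        linarith [half_lt_randomRoutingLimit hS_pos hσ]
      rw [hL]
      refine lt_of_le_of_lt (limsup_le_of_le (by isBoundedDefault) ?_)
        ((ENNReal.ofReal_lt_ofReal_iff hgap).2 (sub_lt_self _ hδ))
      filter_upwards [hbd, heq] with ε h1 h2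
      rw [h2]
      exact ENNReal.ofReal_le_ofReal h1.2
  · intro α hα π hπ
    rw [hL]
    have hq : ∀ᶠ ε in 𝓝[>] (0 : ℝ),
        IsStationary (thresholdStep ⌈(1 / ε) ^ (1 + α)⌉₊ (A ε) S) ((π ε).map Prod.fst) :=
      hIoo.mono fun ε hε => isStationary_map_fst (hload ε hε)
        (Real.rpow_pos_of_pos (one_div_pos.2 hε.1) _) (hπ ε hε)
    exact tendsto_scaledMean_of_imbalance (q := fun ε => (π ε).map Prod.fst) hload' hA_var hq
      (tendsto_imbalance_of_threshold (q := fun ε => (π ε).map Prod.fst) hα hload'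
        (Eventually.of_forall fun ε => Nat.le_ceil _) hq)
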